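/- Let $L/K$ be a finite Galois extension of fields with Galois group $G$, and let $\psi$ be an endomorphism of $G$. Write $[G,\psi]$ for the subgroup of $G$ generated by the elements $g\,\psi(g)^{-1}$, $g\in G$, and suppose that $\psi\bigl([[G,\psi],G]\bigr)\le Z(G)$. Let $\lambda(g)\colon h\mapsto gh$ and $\rho(g)\colon h\mapsto hg^{-1}$ be the left and right regular representations of $G$ in $\mathrm{Perm}(G)$, let $\nu(g)\in\mathrm{Perm}(G)$ be the map $h\mapsto g\,\psi(g)^{-1}\,h\,\psi(g)$, and let $N=\{\nu(g):g\in G\}$. For a subgroup $M\le\mathrm{Perm}(G)$ normalised by $\lambda(G)$, let $G$ act on the group algebra $L[M]$ through the Galois action on $L$ and through conjugation by $\lambda(G)$ on $M$; by Galois descent the algebra of invariants $L[M]^G$ is a $K$-Hopf algebra, with structure maps restricted from $L[M]$. Then $N$ is a regular subgroup of $\mathrm{Perm}(G)$ (that is, $\eta\mapsto\eta(1)$ is a bijection $N\to G$) normalised by $\lambda(G)$, and the following are subgroups of $N$ normalised by $\lambda(G)$: \begin{itemize} \item $N_0=\nu(\ker\psi)=\lambda(\ker\psi)$; \item $N_1=\nu(\mathrm{Fix}\,\psi)=\rho(\mathrm{Fix}\,\psi)$,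 where $\mathrm{Fix}\,\psi=\{g\in G:\psi(g)=g\}$; \item $N_{01}=\langle N_0, N_1\rangle=\nu(\ker\psi\cdot\mathrm{Fix}\,\psi)$, which is the direct product of $N_0$ and $N_1$; more precisely $(a,b)\mapsto\lambda(a)\rho(b)$ is an isomorphism $\ker\psi\times\mathrm{Fix}\,\psi\to N_{01}$; \item $\Lambda_N=\lambda(G)\cap N=\{\lambda(g):\psi(g)\in Z(G)\}$; \item $P_N=\rho(G)\cap N=\{\rho(g):g\,\psi(g)^{-1}\in Z(G)\}$. \end{itemize} For each $M$ among $N_0,N_1,N_{01},\Lambda_N,P_N$, the inclusion $L[M]\subseteq L[N]$ makes $L[M]^G$ a $K$-sub-Hopf algebra of $L[N]^G$. Moreover $L[N_1]^G=K[N_1]$ and $L[P_N]^G=K[P_N]$ (as subsets of $L[N_1]$ and $L[P_N]$, and as $K$-Hopf algebras), and multiplication induces isomorphisms of $K$-Hopf algebras \[ L[N_{01}]^G\;\cong\;(L[N_0]\otimes_L L[N_1])^G\;\cong\; L[N_0]^G\otimes_K K[N_1]. \] Finally, if $\psi$ is idempotent and is not the trivial endomorphism $g\mapsto 1$, then $N=N_{01}$,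 and $(a,b)\mapsto\lambda(a)\rho(b)$ is an isomorphism $\ker\psi\times\psi(G)\to N$. -/

import Mathlib

open scoped TensorProduct
open Coalgebra HopfAlgebra

noncomputable section

/-- The ring endomorphism `x ↦ g • x` of `L`. -/
abbrev galMap {G : Type*} (L : Type*) [Group G] [Field L] [MulSemiringAction G L] (g : G) :
    L →+* L :=
  MulSemiringAction.toRingHom G L g

section LinearDescent

variable {K L G V V₀ ι : Type*} [Field K] [Field L] [Algebra K L] [Group G]
  [MulSemiringAction G L] [IsGaloisGroup G K L] [AddCommGroup V] [Module L V] [Module K V]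
  [IsScalarTower K L V] [AddCommGroup V₀] [Module K V₀]

/-- Independence of the elements of `G` as characters of `L`. -/
theorem galMap_dedekind [Fintype G] (K : Type*) [Field K] [Algebra K L] [IsGaloisGroup G K L]
    (c : G → L) (h : ∀ a : L, ∑ g : G, (g • a) * c g = 0) : c = 0 := by
  have hli := linearIndependent_monoidHom L L
  have hinj : Function.Injective (fun g : G => ((galMap L g : L →+* L) : L →* L)) := by
    intro g g' hgg
    have := (IsGaloisGroup.faithful K : FaithfulSMul G L)
    refine eq_of_smul_eq_smul (α := L) fun x => ?_
    exact DFunLike.congr_fun hgg x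
  have h2 := hli.comp _ hinj
  rw [Fintype.linearIndependent_iff] at h2
  funext g
  refine h2 c ?_ g
  funext a
  have := h a
  simpa [mul_comm] using this

variable (s : (g : G) → V →ₛₗ[galMap L g] V)

theorem descent_span [Finite G] (K : Type*) [Field K] [Algebra K L] [IsGaloisGroup G K L]
    (h1 : ∀ v, s 1 v = v) (hm : ∀ g h v, s (g * h) v = s g (s h v)) :
    Submodule.span L {v : V | ∀ g, s g v = v} = ⊤ := by
  classical
  cases nonempty_fintype G
  by_contra hne
  obtain ⟨φ, hφ, hker⟩ := Submodule.exists_le_ker_of_lt_top _ (lt_top_iff_ne_top.2 hne)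
  refine hφ (LinearMap.ext fun v => ?_)
  have key : (fun g => φ (s g v)) = 0 := by
    refine galMap_dedekind K _ fun a => ?_
    have hinv : (∑ g : G, s g (a • v)) ∈ {v : V | ∀ g, s g v = v} := by
      intro g
      rw [map_sum]
      simp_rw [← hm]
      exact Fintype.sum_equiv (Equiv.mulLeft g) _ _ fun _ => rfl
    have := hker (Submodule.subset_span hinv)
    simpa [LinearMap.mem_ker, map_sum] using this
  have := congr_fun key 1
  simpa [h1] using this

theorem descent_indep [Finite G] (b : ι → V) (hb : LinearIndependent K b) (hinv : ∀ i g, s g (b i) = b i) :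
    LinearIndependent L b := by
  classical
  cases nonempty_fintype G
  rw [linearIndependent_iff'] at hb ⊢
  intro t c hc i hi
  have hc' : (fun g : G => g • c i) = 0 := by
    refine galMap_dedekind K _ fun a => ?_
    have hK : ∀ j, ∃ k : K, algebraMap K L k = ∑ g : G, (g • a) * (g • c j) := by
      intro j
      refine Algebra.IsInvariant.isInvariant (G := G) _ fun h => ?_
      rw [Finset.smul_sum]
      simp_rw [smul_mul', ← mul_smul]
      exact Fintype.sum_equiv (Equiv.mulLeft h) _ _ fun _ => rfl
    choose k hk using hK
    have hsum : ∑ j ∈ t, k j • b j = 0 := by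
      have h0 : ∑ g : G, s g (a • ∑ j ∈ t, c j • b j) = 0 := by simp [hc]
      rw [← h0]
      simp_rw [Finset.smul_sum, map_sum, smul_smul]
      rw [Finset.sum_comm]
      refine Finset.sum_congr rfl fun j _ => ?_
      rw [← algebraMap_smul L (k j) (b j), hk, Finset.sum_smul]
      refine Finset.sum_congr rfl fun g _ => ?_
      rw [LinearMap.map_smulₛₗ, hinv]
      simp [smul_mul']
    rw [← hk i, hb t k hsum i hi, map_zero]
  have := congr_fun hc' 1
  simpa using this

/-- If a `K`-linear map carries a `K`-basis to an `L`-basis it is injective. -/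
theorem injective_of_basis (f : V₀ →ₗ[K] V) (b : Module.Basis ι K V₀) (b' : Module.Basis ι L V)
    (h : ∀ i, b' i = f (b i)) : Function.Injective f := by
  have hli : LinearIndependent K (f ∘ b) := by
    have := b'.linearIndependent.restrict_scalars' K
    convert this using 1
    funext i
    exact (h i).symm
  rw [← LinearMap.ker_eq_bot]
  rw [LinearIndependent, Finsupp.linearCombination] at hli
  rw [LinearMap.ker_eq_bot']
  intro x hx
  apply b.repr.injective
  rw [map_zero]
  apply hli
  rw [map_zero]
  rw [← b.linearCombination_repr x, Finsupp.linearCombination_apply, map_finsuppSum] at hx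
  simpa [Finsupp.linearCombination_apply] using hx

/-- In that case, if the image basis is invariant, then every invariant vector is in the range. -/
theorem mem_range_of_invariant (f : V₀ →ₗ[K] V) (b : Module.Basis ι K V₀)
    (b' : Module.Basis ι L V) (h : ∀ i, b' i = f (b i)) (hinv : ∀ i g, s g (b' i) = b' i)
    (v : V) (hv : ∀ g, s g v = v) : v ∈ LinearMap.range f := by
  have hK : ∀ i, ∃ k : K, algebraMap K L k = b'.repr v i := by
    intro i
    refine Algebra.IsInvariant.isInvariant (G := G) _ fun g => ?_
    have e : v = (b'.repr v).sum fun i c => (g • c) • b' i := by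
      conv_lhs => rw [← hv g, ← b'.linearCombination_repr v, Finsupp.linearCombination_apply,
        map_finsuppSum]
      refine Finsupp.sum_congr fun j _ => ?_
      rw [LinearMap.map_smulₛₗ, hinv]
      rfl
    have e2 : b'.repr v = (b'.repr v).mapRange (fun c => g • c) (smul_zero g) := by
      conv_lhs => rw [e]
      rw [← b'.repr_linearCombination ((b'.repr v).mapRange (fun c => g • c) (smul_zero g))]
      rw [Finsupp.linearCombination_apply, Finsupp.sum_mapRange_index (by simp)]
    conv_rhs => rw [e2]
    rfl
  choose k hk using hK
  rw [← b'.linearCombination_repr v, Finsupp.linearCombination_apply]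
  refine Submodule.sum_mem _ fun i _ => ⟨k i • b i, ?_⟩
  rw [map_smul, ← h, ← hk]
  exact (algebraMap_smul L (k i) (b' i)).symm

end LinearDescent

/-- An action of `G` on an `L`-algebra `A` by ring automorphisms that are semilinear over the
action of `G` on `L`. -/
structure SemilinearAction (G L A : Type*) [Group G] [Field L] [MulSemiringAction G L] [Ring A]
    [Algebra L A] where
  act : G →* RingAut A
  act_smul : ∀ (g : G) (l : L) (a : A), act g (l • a) = (g • l) • act g a

namespace SemilinearAction

variable {G L A B : Type*} [Group G] [Field L] [MulSemiringAction G L] [Ring A] [Algebra L A]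
  [Ring B] [Algebra L B]

/-- The automorphism of `A` given by `g`, as a semilinear map. -/
def toSemilinear (D : SemilinearAction G L A) (g : G) : A →ₛₗ[galMap L g] A where
  toFun := D.act g
  map_add' := map_add _
  map_smul' := D.act_smul g

/-- The diagonal action `g (a ⊗ b) = g a ⊗ g b` of `g` on `A ⊗ B`. -/
def diag (D : SemilinearAction G L A) (E : SemilinearAction G L B) (g : G) :
    A ⊗[L] B →ₛₗ[galMap L g] A ⊗[L] B :=
  TensorProduct.map (D.toSemilinear g) (E.toSemilinear g)

theorem diag_tmul (D : SemilinearAction G L A) (E : SemilinearAction G L B) (g : G) (a : A)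
    (b : B) : D.diag E g (a ⊗ₜ b) = D.act g a ⊗ₜ E.act g b := rfl

theorem diag_one (D : SemilinearAction G L A) (E : SemilinearAction G L B) (x : A ⊗[L] B) :
    D.diag E 1 x = x := by
  induction x with
  | zero => simp
  | tmul a b => simp [diag_tmul]
  | add x y hx hy => rw [map_add, hx, hy]

theorem diag_mul (D : SemilinearAction G L A) (E : SemilinearAction G L B) (g h : G)
    (x : A ⊗[L] B) : D.diag E (g * h) x = D.diag E g (D.diag E h x) := by
  induction x with
  | zero => simp
  | tmul a b => simp [diag_tmul]
  | add x y hx hy => simp only [map_add, hx, hy]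

theorem diag_map_mul (D : SemilinearAction G L A) (E : SemilinearAction G L B) (g : G)
    (x y : A ⊗[L] B) : D.diag E g (x * y) = D.diag E g x * D.diag E g y := by
  induction x with
  | zero => simp
  | add x x' hx hy => simp only [map_add, add_mul, hx, hy]
  | tmul a b =>
    induction y with
    | zero => simp
    | add x x' hx hy => simp only [map_add, mul_add, hx, hy]
    | tmul c d => simp [diag_tmul]

/-- The diagonal action on the tensor product of two algebras with semilinear actions. -/
def tensor (D : SemilinearAction G L A) (E : SemilinearAction G L B) :
    SemilinearAction G L (A ⊗[L] B) where
  act :=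
    { toFun := fun g =>
        { toFun := D.diag E g
          invFun := D.diag E g⁻¹
          left_inv := fun x => by rw [← diag_mul, inv_mul_cancel, diag_one]
          right_inv := fun x => by rw [← diag_mul, mul_inv_cancel, diag_one]
          map_mul' := D.diag_map_mul E g
          map_add' := map_add _ }
      map_one' := RingEquiv.ext (D.diag_one E)
      map_mul' := fun g h => RingEquiv.ext (D.diag_mul E g h) }
  act_smul g l x := (D.diag E g).map_smulₛₗ l x

variable (K : Type*) [Field K] [Algebra K L] [SMulCommClass G K L] [Algebra K A]
  [IsScalarTower K L A]

/-- The `K`-algebra `A ^ G` of invariants. -/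
def invariants (D : SemilinearAction G L A) : Subalgebra K A where
  carrier := {a | ∀ g : G, D.act g a = a}
  mul_mem' ha hb g := by rw [map_mul, ha g, hb g]
  add_mem' ha hb g := by rw [map_add, ha g, hb g]
  algebraMap_mem' k g := by
    rw [Algebra.algebraMap_eq_smul_one, ← algebraMap_smul L, D.act_smul, smul_algebraMap, map_one]

end SemilinearAction

/-- A semilinear action on an `L`-Hopf algebra that is compatible with counit, comultiplication
and antipode. -/
structure HopfAction (G L A : Type*) [Group G] [Field L] [MulSemiringAction G L] [Ring A]
    [HopfAlgebra L A] extends SemilinearAction G L A where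
  counit_act : ∀ (g : G) (a : A), counit (R := L) (act g a) = g • counit (R := L) a
  comul_act : ∀ (g : G) (a : A), comul (R := L) (act g a) =
    toSemilinearAction.diag toSemilinearAction g (comul (R := L) a)
  antipode_act : ∀ (g : G) (a : A), antipode L (act g a) = act g (antipode L a)

/-- The canonical map `V ⊗_K W → A ⊗_L B` induced by `K`-linear maps `V → A` and `W → B`. -/
def tensorComparison (K L : Type*) {A B V W : Type*} [Field K] [Field L] [Algebra K L]
    [AddCommGroup A] [Module L A] [Module K A] [IsScalarTower K L A]
    [AddCommGroup B] [Module L B] [Module K B] [IsScalarTower K L B]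
    [AddCommGroup V] [Module K V] [AddCommGroup W] [Module K W]
    (f : V →ₗ[K] A) (g : W →ₗ[K] B) : V ⊗[K] W →ₗ[K] A ⊗[L] B :=
  TensorProduct.mapOfCompatibleSMul L K K A B ∘ₗ TensorProduct.map f g

section

variable (K L : Type*) {A B V W : Type*} [Field K] [Field L] [Algebra K L]
    [AddCommGroup A] [Module L A] [Module K A] [IsScalarTower K L A]
    [AddCommGroup B] [Module L B] [Module K B] [IsScalarTower K L B]
    [AddCommGroup V] [Module K V] [AddCommGroup W] [Module K W]
    (f : V →ₗ[K] A) (g : W →ₗ[K] B)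

@[simp]
theorem tensorComparison_tmul (v : V) (w : W) :
    tensorComparison K L f g (v ⊗ₜ w) = f v ⊗ₜ g w := rfl

theorem tensorComparison_basis {ι κ : Type*} (b : Module.Basis ι K V) (b' : Module.Basis ι L A)
    (c : Module.Basis κ K W) (c' : Module.Basis κ L B) (hb : ∀ i, b' i = f (b i))
    (hc : ∀ i, c' i = g (c i)) (i : ι × κ) :
    b'.tensorProduct c' i = tensorComparison K L f g (b.tensorProduct c i) := by
  simp [Module.Basis.tensorProduct_apply', hb, hc]

end

namespace HopfAction

variable {K L G A : Type*} [Field K] [Field L] [Algebra K L] [Group G]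
  [MulSemiringAction G L] [IsGaloisGroup G K L] [Ring A] [HopfAlgebra L A] [Algebra K A]
  [IsScalarTower K L A] (D : HopfAction G L A)

variable (K) in
/-- The `K`-algebra `A ^ G`. -/
abbrev inv : Subalgebra K A := D.toSemilinearAction.invariants K

variable (K) in
/-- The inclusion of `A ^ G` into `A`. -/
abbrev incl : D.inv K →ₗ[K] A := (D.inv K).val.toLinearMap

variable (K) in
/-- The canonical map `A ^ G ⊗_K A ^ G → A ⊗_L A`. -/
abbrev incl₂ : D.inv K ⊗[K] D.inv K →ₗ[K] A ⊗[L] A := tensorComparison K L (D.incl K) (D.incl K)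

variable (K) in
/-- The canonical map `A ^ G ⊗_K (A ^ G ⊗_K A ^ G) → A ⊗_L (A ⊗_L A)`. -/
abbrev incl₃ : D.inv K ⊗[K] (D.inv K ⊗[K] D.inv K) →ₗ[K] A ⊗[L] (A ⊗[L] A) :=
  tensorComparison K L (D.incl K) (D.incl₂ K)

section finite

variable [Finite G]

theorem exists_basis : ∃ (s : Set (D.inv K)) (b : Module.Basis s K (D.inv K))
    (b' : Module.Basis s L A), ∀ i, b' i = D.incl K (b i) := by
  let b := Module.Basis.ofVectorSpace K (D.inv K)
  have hinv : ∀ i g, D.toSemilinear g (D.incl K (b i)) = D.incl K (b i) := fun i g => (b i).2 g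
  have hli : LinearIndependent L fun i => D.incl K (b i) := by
    refine descent_indep (K := K) (fun g => D.toSemilinear g) _ ?_ hinv
    exact b.linearIndependent.map' _ (LinearMap.ker_eq_bot.2 Subtype.val_injective)
  have h1 : ∀ v, D.act 1 v = v := fun v => by simp
  have hm : ∀ g h v, D.act (g * h) v = D.act g (D.act h v) := fun g h v => by simp
  refine ⟨_, b, Module.Basis.mk hli ?_, fun i => by simp⟩
  rw [← descent_span (fun g => D.toSemilinear g) K (fun v => h1 v)
    (fun g h v => hm g h v), Submodule.span_le]
  intro v hv
  let w : D.inv K := ⟨v, hv⟩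
  have : v = D.incl K w := rfl
  rw [this, ← b.linearCombination_repr w, Finsupp.linearCombination_apply, map_finsuppSum]
  refine Submodule.sum_mem _ fun i _ => ?_
  change D.incl K (b.repr w i • b i) ∈ _
  rw [map_smul, ← algebraMap_smul L]
  exact Submodule.smul_mem _ _ (Submodule.subset_span ⟨i, rfl⟩)

theorem incl₂_injective : Function.Injective (D.incl₂ K) := by
  obtain ⟨s, b, b', h⟩ := D.exists_basis (K := K)
  exact injective_of_basis _ _ _ (tensorComparison_basis K L _ _ b b' b b' h h)

theorem incl₃_injective : Function.Injective (D.incl₃ K) := by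
  obtain ⟨s, b, b', h⟩ := D.exists_basis (K := K)
  exact injective_of_basis _ _ _ (tensorComparison_basis K L _ _ b b' _ _ h
    (tensorComparison_basis K L _ _ b b' b b' h h))

theorem comul_mem_range (x : D.inv K) : comul (R := L) (x : A) ∈ LinearMap.range (D.incl₂ K) := by
  obtain ⟨s, b, b', h⟩ := D.exists_basis (K := K)
  refine mem_range_of_invariant (fun g => D.diag D.toSemilinearAction g) _ _ _
    (tensorComparison_basis K L _ _ b b' b b' h h) (fun i g => ?_) _ fun g => ?_
  · rw [Module.Basis.tensorProduct_apply', SemilinearAction.diag_tmul, h, h]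
    rw [show D.act g (D.incl K (b i.1)) = _ from (b i.1).2 g,
      show D.act g (D.incl K (b i.2)) = _ from (b i.2).2 g]
    rfl
  · rw [← D.comul_act, x.2 g]

/-- The comultiplication of `A ^ G`: the restriction of that of `A`, where `A ^ G ⊗_K A ^ G` is
identified with its image in `A ⊗_L A`. -/
def comulInv : D.inv K →ₗ[K] D.inv K ⊗[K] D.inv K :=
  (LinearEquiv.ofInjective (D.incl₂ K) D.incl₂_injective).symm.toLinearMap ∘ₗ
    LinearMap.codRestrict (LinearMap.range (D.incl₂ K))
      ((comul (R := L) (A := A)).restrictScalars K ∘ₗ D.incl K) D.comul_mem_range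

theorem incl₂_comulInv (x : D.inv K) : D.incl₂ K (D.comulInv x) = comul (R := L) (x : A) := by
  have := (LinearEquiv.ofInjective (D.incl₂ K) D.incl₂_injective).apply_symm_apply
    ⟨comul (R := L) (x : A), D.comul_mem_range x⟩
  exact congr_arg Subtype.val this

end finite

theorem exists_counit (x : D.inv K) : ∃ k : K, algebraMap K L k = counit (R := L) (x : A) :=
  Algebra.IsInvariant.isInvariant (G := G) _ fun g => by rw [← D.counit_act, x.2 g]

/-- The counit of `A ^ G`: the restriction of that of `A`, with values in `K = L ^ G`. -/
def counitInv : D.inv K →ₗ[K] K where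
  toFun x := (D.exists_counit x).choose
  map_add' x y := (algebraMap K L).injective <| by
    rw [map_add, (D.exists_counit _).choose_spec, (D.exists_counit _).choose_spec,
      (D.exists_counit _).choose_spec]
    simp
  map_smul' k x := (algebraMap K L).injective <| by
    rw [RingHom.id_apply, smul_eq_mul, map_mul, (D.exists_counit _).choose_spec,
      (D.exists_counit _).choose_spec]
    have : ((k • x : D.inv K) : A) = algebraMap K L k • (x : A) := by simp
    rw [this, map_smul, smul_eq_mul]

theorem algebraMap_counitInv (x : D.inv K) :
    algebraMap K L (D.counitInv x) = counit (R := L) (x : A) :=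
  (D.exists_counit x).choose_spec

/-- The antipode of `A ^ G`: the restriction of that of `A`. -/
def antipodeInv : D.inv K →ₗ[K] D.inv K :=
  LinearMap.restrict (p := Subalgebra.toSubmodule (D.inv K)) (q := Subalgebra.toSubmodule (D.inv K))
    ((antipode L (A := A)).restrictScalars K)
    fun x hx g => by
      change D.act g (antipode L x) = antipode L x
      rw [← D.antipode_act, hx g]

theorem coe_antipodeInv (x : D.inv K) : ((D.antipodeInv x : D.inv K) : A) = antipode L (x : A) :=
  rfl

theorem incl₂_mul (x y : D.inv K ⊗[K] D.inv K) :
    D.incl₂ K (x * y) = D.incl₂ K x * D.incl₂ K y := by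
  induction x with
  | zero => simp
  | add x x' hx hy => simp only [map_add, add_mul, hx, hy]
  | tmul a b =>
    induction y with
    | zero => simp
    | add x x' hx hy => simp only [map_add, mul_add, hx, hy]
    | tmul c d => simp

variable [Finite G]

set_option synthInstance.maxHeartbeats 200000 in
instance coalgebraInv : Coalgebra K (D.inv K) where
  comul := D.comulInv
  counit := D.counitInv
  coassoc := by
    have hassoc : ∀ (u : D.inv K ⊗[K] D.inv K) (y : D.inv K),
        D.incl₃ K (TensorProduct.assoc K _ _ _ (u ⊗ₜ y)) =
          TensorProduct.assoc L A A A (D.incl₂ K u ⊗ₜ (y : A)) := by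
      intro u y
      induction u with
      | zero => simp
      | tmul a b => simp
      | add a b ha hb => simp only [TensorProduct.add_tmul, map_add, ha, hb]
    have hr : ∀ t : D.inv K ⊗[K] D.inv K,
        D.incl₃ K (TensorProduct.assoc K _ _ _ (D.comulInv.rTensor _ t)) =
          TensorProduct.assoc L A A A ((comul (R := L) (A := A)).rTensor A (D.incl₂ K t)) := by
      intro t
      induction t with
      | zero => simp
      | tmul a b => simp [hassoc, incl₂_comulInv]
      | add a b ha hb => simp only [map_add, ha, hb]
    have hl : ∀ t : D.inv K ⊗[K] D.inv K,
        D.incl₃ K (D.comulInv.lTensor _ t) =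
          (comul (R := L) (A := A)).lTensor A (D.incl₂ K t) := by
      intro t
      induction t with
      | zero => simp
      | tmul a b => simp [incl₂_comulInv]
      | add a b ha hb => simp only [map_add, ha, hb]
    refine LinearMap.ext fun x => D.incl₃_injective ?_
    change D.incl₃ K (TensorProduct.assoc K _ _ _ (D.comulInv.rTensor _ (D.comulInv x))) =
      D.incl₃ K (D.comulInv.lTensor _ (D.comulInv x))
    rw [hr, hl, incl₂_comulInv, coassoc_apply]
  rTensor_counit_comp_comul := by
    have hr : ∀ t : D.inv K ⊗[K] D.inv K,
        ((TensorProduct.lid K (D.inv K) (D.counitInv.rTensor _ t) : D.inv K) : A) =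
          TensorProduct.lid L A ((counit (R := L) (A := A)).rTensor A (D.incl₂ K t)) := by
      intro t
      induction t with
      | zero => simp
      | tmul a b => simp [← algebraMap_counitInv]
      | add a b ha hb => simp only [map_add, ← ha, ← hb, AddMemClass.coe_add]
    refine LinearMap.ext fun x => (TensorProduct.lid K (D.inv K)).injective (Subtype.ext ?_)
    change ((TensorProduct.lid K (D.inv K) (D.counitInv.rTensor _ (D.comulInv x)) : D.inv K) : A) = _
    rw [hr, incl₂_comulInv, rTensor_counit_comul]
    simp
  lTensor_counit_comp_comul := by
    have hl : ∀ t : D.inv K ⊗[K] D.inv K,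
        ((TensorProduct.rid K (D.inv K) (D.counitInv.lTensor _ t) : D.inv K) : A) =
          TensorProduct.rid L A ((counit (R := L) (A := A)).lTensor A (D.incl₂ K t)) := by
      intro t
      induction t with
      | zero => simp
      | tmul a b => simp [← algebraMap_counitInv]
      | add a b ha hb => simp only [map_add, ← ha, ← hb, AddMemClass.coe_add]
    refine LinearMap.ext fun x => (TensorProduct.rid K (D.inv K)).injective (Subtype.ext ?_)
    change ((TensorProduct.rid K (D.inv K) (D.counitInv.lTensor _ (D.comulInv x)) : D.inv K) : A) = _
    rw [hl, incl₂_comulInv, lTensor_counit_comul]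
    simp

instance bialgebraInv : Bialgebra K (D.inv K) :=
  Bialgebra.mk' K (D.inv K)
    ((algebraMap K L).injective <| by
      change algebraMap K L (D.counitInv 1) = _
      rw [algebraMap_counitInv]; simp)
    (fun {a b} => (algebraMap K L).injective <| by
      change algebraMap K L (D.counitInv (a * b)) =
        algebraMap K L (D.counitInv a * D.counitInv b)
      rw [RingHom.map_mul]
      simp only [algebraMap_counitInv]
      simp)
    (D.incl₂_injective <| by
      change D.incl₂ K (D.comulInv 1) = _
      rw [incl₂_comulInv]; simp [Algebra.TensorProduct.one_def])
    (fun {a b} => D.incl₂_injective <| by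
      change D.incl₂ K (D.comulInv (a * b)) = D.incl₂ K (D.comulInv a * D.comulInv b)
      rw [incl₂_mul]
      simp only [incl₂_comulInv]
      simp)

/-- The `K`-Hopf algebra `A ^ G`. -/
instance hopfAlgebraInv : HopfAlgebra K (D.inv K) where
  antipode := D.antipodeInv
  mul_antipode_rTensor_comul := by
    have hr : ∀ t : D.inv K ⊗[K] D.inv K,
        ((LinearMap.mul' K (D.inv K) (D.antipodeInv.rTensor _ t) : D.inv K) : A) =
          LinearMap.mul' L A ((antipode L (A := A)).rTensor A (D.incl₂ K t)) := by
      intro t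
      induction t with
      | zero => simp
      | tmul a b => simp [coe_antipodeInv]
      | add a b ha hb => simp only [map_add, ← ha, ← hb, AddMemClass.coe_add]
    refine LinearMap.ext fun x => Subtype.ext ?_
    change ((LinearMap.mul' K (D.inv K) (D.antipodeInv.rTensor _ (D.comulInv x)) : D.inv K) : A) =
      algebraMap K A (D.counitInv x)
    rw [hr, incl₂_comulInv, mul_antipode_rTensor_comul_apply, IsScalarTower.algebraMap_apply K L A,
      algebraMap_counitInv]
  mul_antipode_lTensor_comul := by
    have hl : ∀ t : D.inv K ⊗[K] D.inv K,
        ((LinearMap.mul' K (D.inv K) (D.antipodeInv.lTensor _ t) : D.inv K) : A) =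
          LinearMap.mul' L A ((antipode L (A := A)).lTensor A (D.incl₂ K t)) := by
      intro t
      induction t with
      | zero => simp
      | tmul a b => simp [coe_antipodeInv]
      | add a b ha hb => simp only [map_add, ← ha, ← hb, AddMemClass.coe_add]
    refine LinearMap.ext fun x => Subtype.ext ?_
    change ((LinearMap.mul' K (D.inv K) (D.antipodeInv.lTensor _ (D.comulInv x)) : D.inv K) : A) =
      algebraMap K A (D.counitInv x)
    rw [hl, incl₂_comulInv, mul_antipode_lTensor_comul_apply, IsScalarTower.algebraMap_apply K L A,
      algebraMap_counitInv]

end HopfAction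

section Constructions

variable {G L A B M : Type*} [Group G] [Field L] [MulSemiringAction G L]

/-- If `G` acts on a group `M` by automorphisms, then it acts on the group algebra `L[M]` by
`g (∑ lᵢ mᵢ) = ∑ g(lᵢ) g(mᵢ)`. -/
def groupAlgebraSemilinear [Group M] (α : G →* MulAut M) :
    SemilinearAction G L (MonoidAlgebra L M) where
  act :=
    { toFun := fun g =>
        (MonoidAlgebra.mapRingEquiv M (MulSemiringAction.toRingEquiv G L g)).trans
          (MonoidAlgebra.mapDomainRingEquiv L (α g))
      map_one' := by
        refine RingEquiv.ext fun x => ?_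
        induction x using MonoidAlgebra.induction_linear with
        | zero => simp
        | add x y hx hy => rw [map_add, hx, hy, map_add]
        | single m l => simp
      map_mul' := fun g h => by
        refine RingEquiv.ext fun x => ?_
        induction x using MonoidAlgebra.induction_linear with
        | zero => simp
        | add x y hx hy => rw [map_add, hx, hy, map_add]
        | single m l => simp }
  act_smul g l x := by
    induction x using MonoidAlgebra.induction_linear with
    | zero => simp
    | add x y hx hy => rw [smul_add, map_add, hx, hy, map_add, smul_add]
    | single m l => simp [smul_mul']

theorem groupAlgebraSemilinear_single [Group M] (α : G →* MulAut M) (g : G) (m : M) (l : L) :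
    (groupAlgebraSemilinear α).act g (MonoidAlgebra.single m l) =
      MonoidAlgebra.single (α g m) (g • l) := by
  simp [groupAlgebraSemilinear]

variable (L) in
/-- The same action, which is compatible with the Hopf algebra structure of `L[M]`. -/
def groupAlgebraAction [Group M] (α : G →* MulAut M) : HopfAction G L (MonoidAlgebra L M) where
  toSemilinearAction := groupAlgebraSemilinear α
  counit_act g x := by
    induction x using MonoidAlgebra.induction_linear with
    | zero => simp
    | add x y hx hy => rw [map_add, map_add, hx, hy, map_add, smul_add]
    | single m l => rw [groupAlgebraSemilinear_single]; simp
  comul_act g x := by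
    induction x using MonoidAlgebra.induction_linear with
    | zero => simp
    | add x y hx hy => rw [map_add, map_add, hx, hy, map_add, map_add]
    | single m l =>
      rw [groupAlgebraSemilinear_single, MonoidAlgebra.comul_single, MonoidAlgebra.comul_single]
      simp [SemilinearAction.diag_tmul, groupAlgebraSemilinear_single]
  antipode_act g x := by
    induction x using MonoidAlgebra.induction_linear with
    | zero => simp
    | add x y hx hy => rw [map_add, map_add, hx, hy, map_add, map_add]
    | single m l =>
      rw [groupAlgebraSemilinear_single, MonoidAlgebra.antipode_single,
        MonoidAlgebra.antipode_single, groupAlgebraSemilinear_single]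
      simp

/-- The diagonal action on the tensor product of two Hopf algebras. -/
def HopfAction.tensor [Ring A] [HopfAlgebra L A] [Ring B] [HopfAlgebra L B]
    (D : HopfAction G L A) (E : HopfAction G L B) : HopfAction G L (A ⊗[L] B) where
  toSemilinearAction := D.toSemilinearAction.tensor E.toSemilinearAction
  counit_act g x := by
    change counit (R := L) (D.diag E.toSemilinearAction g x) = _
    induction x with
    | zero => simp
    | add x y hx hy => rw [map_add, map_add, hx, hy, map_add, smul_add]
    | tmul a b =>
      simp [SemilinearAction.diag_tmul, D.counit_act, E.counit_act, smul_mul']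
  comul_act g x := by
    change comul (R := L) (D.diag E.toSemilinearAction g x) = _
    have key : ∀ (u : A ⊗[L] A) (v : B ⊗[L] B),
        TensorProduct.AlgebraTensorModule.tensorTensorTensorComm L L L L A A B B
          (D.diag D.toSemilinearAction g u ⊗ₜ E.diag E.toSemilinearAction g v) =
        (D.toSemilinearAction.tensor E.toSemilinearAction).diag
          (D.toSemilinearAction.tensor E.toSemilinearAction) g
          (TensorProduct.AlgebraTensorModule.tensorTensorTensorComm L L L L A A B B (u ⊗ₜ v)) := by
      intro u v
      induction u with
      | zero => simp
      | add x y hx hy => simp only [map_add, TensorProduct.add_tmul, hx, hy]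
      | tmul a b =>
        induction v with
        | zero => simp
        | add x y hx hy => simp only [map_add, TensorProduct.tmul_add, hx, hy]
        | tmul c d => rfl
    induction x with
    | zero => simp
    | add x y hx hy => rw [map_add, map_add, hx, hy, map_add, map_add]
    | tmul a b =>
      rw [SemilinearAction.diag_tmul, TensorProduct.comul_tmul, TensorProduct.comul_tmul,
        D.comul_act, E.comul_act, key]
  antipode_act g x := by
    change antipode L (D.diag E.toSemilinearAction g x) =
      D.diag E.toSemilinearAction g (antipode L x)
    induction x with
    | zero => simp
    | add x y hx hy => rw [map_add, map_add, hx, hy, map_add, map_add]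
    | tmul a b =>
      simp [SemilinearAction.diag_tmul, D.antipode_act, E.antipode_act]

end Constructions

/-- A subalgebra `S` of a Hopf algebra over a field is a sub-Hopf algebra if `Δ(S) ⊆ S ⊗ S` and it
is stable under the antipode. -/
structure IsSubHopfAlgebra {K H : Type*} [Field K] [Ring H] [HopfAlgebra K H]
    (S : Subalgebra K H) : Prop where
  comul_mem : ∀ x ∈ S, comul (R := K) x ∈
    LinearMap.range (TensorProduct.map S.val.toLinearMap S.val.toLinearMap)
  antipode_mem : ∀ x ∈ S, antipode K x ∈ S

section Groups

variable {G : Type*} [Group G]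

/-- The left regular representation `λ(g) : h ↦ g h`. -/
def lam : G →* Equiv.Perm G where
  toFun g := Equiv.mulLeft g
  map_one' := by ext; simp
  map_mul' a b := by ext; simp

/-- The right regular representation `ρ(g) : h ↦ h g⁻¹`. -/
def rho : G →* Equiv.Perm G where
  toFun g := Equiv.mulRight g⁻¹
  map_one' := by ext; simp
  map_mul' a b := by ext; simp [mul_assoc]

/-- The permutation `ν(g) : h ↦ g ψ(g)⁻¹ h ψ(g)`. -/
def nu (ψ : G →* G) (g : G) : Equiv.Perm G :=
  (Equiv.mulLeft (g * (ψ g)⁻¹)).trans (Equiv.mulRight (ψ g))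

/-- `[G, ψ]`, the subgroup generated by the elements `g ψ(g)⁻¹`. -/
def commEnd (ψ : G →* G) : Subgroup G :=
  Subgroup.closure (Set.range fun g => g * (ψ g)⁻¹)

/-- The subgroup of fixed points of `ψ`. -/
def fixSubgroup (ψ : G →* G) : Subgroup G :=
  ψ.eqLocus (MonoidHom.id G)

/-- A subgroup of `Perm G` is regular if `η ↦ η(1)` is a bijection from it to `G`. -/
def IsRegularSubgroup (M : Subgroup (Equiv.Perm G)) : Prop :=
  Function.Bijective fun η : M => (η : Equiv.Perm G) 1

/-- `M` is normalised by `λ(G)`. -/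
def NormalisedByLam (M : Subgroup (Equiv.Perm G)) : Prop :=
  (lam (G := G)).range ≤ Subgroup.normalizer (M : Set (Equiv.Perm G))

/-- `N₀ = λ(ker ψ)`. -/
def subN0 (ψ : G →* G) : Subgroup (Equiv.Perm G) := ψ.ker.map lam

/-- `N₁ = ρ(Fix ψ)`. -/
def subN1 (ψ : G →* G) : Subgroup (Equiv.Perm G) := (fixSubgroup ψ).map rho

/-- `N₀₁`, the subgroup generated by `N₀` and `N₁`. -/
def subN01 (ψ : G →* G) : Subgroup (Equiv.Perm G) := subN0 ψ ⊔ subN1 ψ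

/-- The `λ`-points of `N`. -/
def lamPoints (N : Subgroup (Equiv.Perm G)) : Subgroup (Equiv.Perm G) := lam.range ⊓ N

/-- The `ρ`-points of `N`. -/
def rhoPoints (N : Subgroup (Equiv.Perm G)) : Subgroup (Equiv.Perm G) := rho.range ⊓ N

/-- The action of `G` on `M` by `g · η = λ(g) η λ(g)⁻¹`. -/
def conjAction {M : Subgroup (Equiv.Perm G)} (hM : NormalisedByLam M) : G →* MulAut M :=
  (Subgroup.normalizerMonoidHom M).comp
    (lam.codRestrict (Subgroup.normalizer (M : Set (Equiv.Perm G))) fun g => hM ⟨g, rfl⟩)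

theorem coe_conjAction {M : Subgroup (Equiv.Perm G)} (hM : NormalisedByLam M) (g : G) (η : M) :
    (conjAction hM g η : Equiv.Perm G) = lam g * η * (lam g)⁻¹ := rfl

end Groups

section HopfOfSubgroup

variable {G : Type*} (K L : Type*) [Group G] [Field K] [Field L] [Algebra K L]
  [MulSemiringAction G L] [IsGaloisGroup G K L] {M N : Subgroup (Equiv.Perm G)}

/-- The `K`-algebra `L[M] ^ G`, where `G` acts on `L` as Galois group and on `M` by conjugation
via `λ`. For finite `G` it is a `K`-Hopf algebra by `HopfAction.hopfAlgebraInv`. -/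
abbrev invAlg (hM : NormalisedByLam M) : Subalgebra K (MonoidAlgebra L M) :=
  (groupAlgebraAction L (conjAction hM)).inv K

/-- For `M ≤ N`, the inclusion `L[M] → L[N]` embeds `L[M] ^ G` into `L[N] ^ G` as a `K`-sub-Hopf
algebra: it restricts to an injective morphism of bialgebras whose range is a sub-Hopf algebra. -/
def IsSubHopfOf [Finite G] (hM : NormalisedByLam M) (hN : NormalisedByLam N) (hMN : M ≤ N) :
    Prop :=
  ∃ f : invAlg K L hM →ₐc[K] invAlg K L hN,
    (∀ x, (f x : MonoidAlgebra L N) =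
      MonoidAlgebra.mapDomain (Subgroup.inclusion hMN) (x : MonoidAlgebra L M)) ∧
    Function.Injective f ∧
    IsSubHopfAlgebra (f : invAlg K L hM →ₐ[K] invAlg K L hN).range

/-- `L[M] ^ G = K[M]`: the invariants are the elements of `L[M]` with coefficients in `K`, and
extension of coefficients is an isomorphism of Hopf algebras from `K[M]` to `L[M] ^ G`. -/
def InvEqGroupAlgebra [Finite G] (hM : NormalisedByLam M) : Prop :=
  invAlg K L hM = (MonoidAlgebra.mapAlgHom M (Algebra.ofId K L)).range ∧
  ∃ e : MonoidAlgebra K M ≃ₐc[K] invAlg K L hM,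
    ∀ x, (e x : MonoidAlgebra L M) = MonoidAlgebra.mapAlgHom M (Algebra.ofId K L) x

end HopfOfSubgroup

end

noncomputable section

/-! ### The regular subgroup N and its distinguished subgroups. -/

section RegularSubgroups

variable {G : Type*} [Group G]

/-! Every permutation involved has the form `h ↦ x * h * y`, and once the value `x * y` at 1 is
known, only the class of `y` modulo the centre matters (`mul_mul_eq_of_center`). For `nu ψ g` the
value at 1 is `g` and the right factor is `ψ g`. So a product of two `nu`'s, or a conjugate of one
by `lam a`, can only be `nu` of its own value at 1, and it is so exactly when the right factors
agree modulo the centre. The hypothesis on `ψ` supplies that agreement (`map_mul_eq_center_mul`).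
Hence N is a subgroup normalised by `λ(G)`, and it is regular because `g` is recovered from `nu ψ g`
by evaluating at 1. The descriptions of the five subgroups come from the same evaluation, and the
product over `ker ψ` and `Fix ψ` is direct because left and right translations commute and the two
groups meet trivially.

The Hopf part is Galois descent. A `K`-basis of `A ^ G` can be chosen that is also an `L`-basis of
`A` (`exists_basis`), so tensor products of invariants embed in tensor products over `L`, and
identities between structure maps can be checked there. Consequently equivariant bialgebra morphisms
restrict to invariants (`mapInv`), and invariants commute with tensor products
(`tensorInv_bijective`). A subgroup of `ρ(G)` is centralised by `λ(G)`, so there the action only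
moves coefficients and the invariants are `K[M]` (`inv_groupAlgebra_eq`). -/

theorem lam_apply (g h : G) : lam g h = g * h := rfl

theorem rho_apply (g h : G) : rho g h = h * g⁻¹ := rfl

theorem nu_apply (ψ : G →* G) (g h : G) : nu ψ g h = g * (ψ g)⁻¹ * h * ψ g := rfl

theorem nu_apply_one (ψ : G →* G) (g : G) : nu ψ g 1 = g := by simp [nu_apply]

theorem lam_mul_rho_comm (a b : G) : lam a * rho b = rho b * lam a := by
  ext h
  simp [lam_apply, rho_apply, mul_assoc]

theorem lam_conj_rho (a b : G) : lam a * rho b * (lam a)⁻¹ = rho b := by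
  rw [lam_mul_rho_comm, mul_inv_cancel_right]

/-- Two maps `h ↦ x h y` that agree at `1` agree if their right factors agree modulo the centre. -/
theorem mul_mul_eq_of_center {x y x' y' z : G} (hz : z ∈ Subgroup.center G)
    (h1 : x * y = x' * y') (h2 : y = z * y') (h : G) : x * h * y = x' * h * y' := by
  -- If the right factors differ by `z`, equality at 1 forces the left factors to differ by `z` too;
  -- being central, it can be moved across `h`.
  have hx : x' = x * z := by
    rw [h2, ← mul_assoc] at h1
    exact (mul_right_cancel h1).symm
  rw [hx, h2, mul_assoc x z h, ← Subgroup.mem_center_iff.1 hz h]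
  simp only [mul_assoc]

/-- `ν(x)` is determined by its value at `1` and the class of `ψ(x)` modulo the centre. -/
theorem nu_eq_of_center (ψ : G →* G) {x a b z : G} (hz : z ∈ Subgroup.center G)
    (h1 : x = a * b) (h2 : ψ x = z * b) (h : G) : nu ψ x h = a * h * b :=
  mul_mul_eq_of_center hz (by rw [← h1]; exact inv_mul_cancel_right x (ψ x)) h2 h

variable {ψ : G →* G}

/-- Elements of `[G, ψ]` commute with all elements modulo the centre, after applying `ψ`. -/
theorem map_mul_eq_center_mul (hψ : (⁅commEnd ψ, (⊤ : Subgroup G)⁆).map ψ ≤ Subgroup.center G)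
    (g h : G) : ∃ z ∈ Subgroup.center G,
      ψ (g * (ψ g)⁻¹ * h) = z * ψ (h * (g * (ψ g)⁻¹)) := by
  -- With `u = g * (ψ g)⁻¹`, the witness is `ψ` of the commutator of `u` and `h`, from `u h = [u, h]
  -- h u`.
  refine ⟨ψ (g * (ψ g)⁻¹ * h * (g * (ψ g)⁻¹)⁻¹ * h⁻¹), hψ (Subgroup.mem_map_of_mem ψ (Subgroup.commutator_mem_commutator
    (Subgroup.subset_closure ⟨g, rfl⟩) (Subgroup.mem_top h))), ?_⟩
  rw [← map_mul]
  congr 1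
  group

/-- The argument on the right is the value of the product at 1, the only possible one. The right
factors to compare are `ψ h * ψ g` and `ψ` of that argument; swapping `g * (ψ g)⁻¹` past `h` under
`ψ` costs a central element. -/
theorem nu_mul_nu (hψ : (⁅commEnd ψ, (⊤ : Subgroup G)⁆).map ψ ≤ Subgroup.center G) (g h : G) :
    nu ψ g * nu ψ h = nu ψ (g * (ψ g)⁻¹ * h * ψ g) := by
  obtain ⟨z, hz, e⟩ := map_mul_eq_center_mul hψ g h
  ext k
  rw [nu_eq_of_center ψ (a := g * (ψ g)⁻¹ * h * (ψ h)⁻¹) (b := ψ h * ψ g) hz (by group) ?_ k]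
  · simp [nu_apply, mul_assoc]
  · rw [map_mul, e, mul_assoc, ← map_mul, ← map_mul]
    simp [mul_assoc]

/-- Again the argument is the value at 1. The right factor stays `ψ g`, and `ψ` of the argument
reduces to it modulo the centre by the swap applied with `h = a⁻¹`. -/
theorem lam_conj_nu (hψ : (⁅commEnd ψ, (⊤ : Subgroup G)⁆).map ψ ≤ Subgroup.center G) (a g : G) :
    lam a * nu ψ g * (lam a)⁻¹ = nu ψ (a * g * (ψ g)⁻¹ * a⁻¹ * ψ g) := by
  obtain ⟨z, hz, e⟩ := map_mul_eq_center_mul hψ g a⁻¹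
  ext k
  rw [nu_eq_of_center ψ (a := a * g * (ψ g)⁻¹ * a⁻¹) (b := ψ g) hz rfl ?_ k]
  · rw [← map_inv, Equiv.Perm.mul_apply, Equiv.Perm.mul_apply, nu_apply, lam_apply, lam_apply]
    simp only [mul_assoc]
  · have : a * g * (ψ g)⁻¹ * a⁻¹ * ψ g = a * (g * (ψ g)⁻¹ * a⁻¹) * ψ g := by group
    rw [this, map_mul, map_mul, e, ← mul_assoc, Subgroup.mem_center_iff.1 hz, mul_assoc,
      mul_assoc, ← map_mul, ← map_mul]
    congr 2
    group

/-- The subgroup `N = {ν(g) : g ∈ G}`. -/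
def nuSubgroup (ψ : G →* G)
    (hψ : (⁅commEnd ψ, (⊤ : Subgroup G)⁆).map ψ ≤ Subgroup.center G) :
    Subgroup (Equiv.Perm G) where
  carrier := Set.range (nu ψ)
  mul_mem' := by
    rintro _ _ ⟨g, rfl⟩ ⟨h, rfl⟩
    exact ⟨_, (nu_mul_nu hψ g h).symm⟩
  one_mem' := ⟨1, by ext; simp [nu_apply]⟩
  inv_mem' := by
    rintro _ ⟨g, rfl⟩
    -- The witness is the point that `nu ψ g` sends to 1.
    refine ⟨ψ g * g⁻¹ * (ψ g)⁻¹, eq_inv_of_mul_eq_one_right ?_⟩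
    rw [nu_mul_nu hψ]
    ext
    simp [nu_apply, mul_assoc]

/-- Stability in one direction suffices: applied to `a⁻¹` it gives the converse. -/
theorem normalisedByLam_of_conj_mem {M : Subgroup (Equiv.Perm G)}
    (h : ∀ (a : G), ∀ η ∈ M, lam a * η * (lam a)⁻¹ ∈ M) : NormalisedByLam M := by
  rintro _ ⟨a, rfl⟩
  refine Subgroup.mem_normalizer_iff.2 fun η => ⟨h a η, fun hη => ?_⟩
  have := h a⁻¹ _ hη
  rw [map_inv] at this
  simpa [mul_assoc] using this

theorem NormalisedByLam.conj_mem {M : Subgroup (Equiv.Perm G)} (hM : NormalisedByLam M) (a : G)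
    {η : Equiv.Perm G} (hη : η ∈ M) : lam a * η * (lam a)⁻¹ ∈ M :=
  (Subgroup.mem_normalizer_iff.1 (hM ⟨a, rfl⟩) η).1 hη

theorem NormalisedByLam.sup {M N : Subgroup (Equiv.Perm G)} (hM : NormalisedByLam M)
    (hN : NormalisedByLam N) : NormalisedByLam (M ⊔ N) := by
  refine normalisedByLam_of_conj_mem fun a η hη => ?_
  -- The pullback of `M ⊔ N` along conjugation is a subgroup, so it need only contain `M` and `N`.
  have : M ⊔ N ≤ (M ⊔ N).comap (MulAut.conj (lam a)).toMonoidHom := by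
    refine sup_le (fun x hx => ?_) fun x hx => ?_
    · exact Subgroup.mem_sup_left (hM.conj_mem a hx)
    · exact Subgroup.mem_sup_right (hN.conj_mem a hx)
  exact this hη

theorem NormalisedByLam.inf {M N : Subgroup (Equiv.Perm G)} (hM : NormalisedByLam M)
    (hN : NormalisedByLam N) : NormalisedByLam (M ⊓ N) :=
  normalisedByLam_of_conj_mem fun a _ hη => ⟨hM.conj_mem a hη.1, hN.conj_mem a hη.2⟩

theorem normalisedByLam_nuSubgroup
    (hψ : (⁅commEnd ψ, (⊤ : Subgroup G)⁆).map ψ ≤ Subgroup.center G) :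
    NormalisedByLam (nuSubgroup ψ hψ) :=
  normalisedByLam_of_conj_mem <| by
    rintro a _ ⟨g, rfl⟩
    exact ⟨_, (lam_conj_nu hψ a g).symm⟩

theorem normalisedByLam_map_lam (H : Subgroup G) [H.Normal] : NormalisedByLam (H.map lam) :=
  normalisedByLam_of_conj_mem <| by
    rintro a _ ⟨g, hg, rfl⟩
    exact ⟨a * g * a⁻¹, Subgroup.Normal.conj_mem inferInstance g hg a, by simp⟩

/-- Left and right translations commute. This trivial action makes subgroups of `ρ(G)` normalised by
`λ(G)`, and later reduces their descended algebras to `K[M]`. -/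
theorem lam_conj_of_le_rho {M : Subgroup (Equiv.Perm G)} (hM : M ≤ rho.range) (a : G)
    {η : Equiv.Perm G} (hη : η ∈ M) : lam a * η * (lam a)⁻¹ = η := by
  obtain ⟨b, rfl⟩ := hM hη
  exact lam_conj_rho a b

theorem normalisedByLam_of_le_rho {M : Subgroup (Equiv.Perm G)} (hM : M ≤ rho.range) :
    NormalisedByLam M :=
  normalisedByLam_of_conj_mem fun a η hη => by rwa [lam_conj_of_le_rho hM a hη]

theorem isRegularSubgroup_nuSubgroup
    (hψ : (⁅commEnd ψ, (⊤ : Subgroup G)⁆).map ψ ≤ Subgroup.center G) :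
    IsRegularSubgroup (nuSubgroup ψ hψ) := by
  constructor
  · rintro ⟨_, g, rfl⟩ ⟨_, h, rfl⟩ e
    simp only [nu_apply_one] at e
    rw [e]
  · exact fun g => ⟨⟨_, g, rfl⟩, nu_apply_one ψ g⟩

theorem nu_of_mem_ker {g : G} (hg : g ∈ ψ.ker) : nu ψ g = lam g := by
  ext h
  simp [nu_apply, lam_apply, MonoidHom.mem_ker.1 hg]

theorem mem_fixSubgroup {g : G} : g ∈ fixSubgroup ψ ↔ ψ g = g := Iff.rfl

/-- The inverse on `b` matches the convention that `rho b` multiplies by `b⁻¹`: here `ψ (a * b⁻¹) =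
b⁻¹`, which becomes the right factor and leaves `a` on the left. -/
theorem nu_mul_inv {a b : G} (ha : a ∈ ψ.ker) (hb : b ∈ fixSubgroup ψ) :
    nu ψ (a * b⁻¹) = lam a * rho b := by
  ext h
  simp [nu_apply, lam_apply, rho_apply, MonoidHom.mem_ker.1 ha, mem_fixSubgroup.1 hb, mul_assoc]

theorem nu_of_mem_fix {b : G} (hb : b ∈ fixSubgroup ψ) : nu ψ b⁻¹ = rho b := by
  simpa using nu_mul_inv (one_mem ψ.ker) hb

theorem coe_subN0 (ψ : G →* G) : (subN0 ψ : Set (Equiv.Perm G)) = nu ψ '' ψ.ker := by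
  rw [subN0, Subgroup.coe_map]
  exact Set.image_congr fun g hg => (nu_of_mem_ker hg).symm

theorem coe_subN1 (ψ : G →* G) : (subN1 ψ : Set (Equiv.Perm G)) = nu ψ '' fixSubgroup ψ := by
  rw [subN1, Subgroup.coe_map]
  ext η
  constructor
  · rintro ⟨b, hb, rfl⟩
    exact ⟨b⁻¹, inv_mem hb, nu_of_mem_fix hb⟩
  · rintro ⟨b, hb, rfl⟩
    exact ⟨b⁻¹, inv_mem hb, by rw [← nu_of_mem_fix (inv_mem hb), inv_inv]⟩

theorem subN1_le_rho (ψ : G →* G) : subN1 ψ ≤ rho.range := by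
  rintro _ ⟨b, _, rfl⟩
  exact ⟨b, rfl⟩

/-- The homomorphism `(a, b) ↦ λ(a) ρ(b)`. -/
def lamRho : G × G →* Equiv.Perm G :=
  lam.noncommCoprod rho fun a b => lam_mul_rho_comm a b

theorem lamRho_apply (a b : G) : lamRho (a, b) = lam a * rho b := rfl

/-- Since `lam` and `rho` commute, `lamRho` is a homomorphism, so the join of the two images is the
image of the product subgroup. -/
theorem mem_subN01 {η : Equiv.Perm G} :
    η ∈ subN01 ψ ↔ ∃ a ∈ ψ.ker, ∃ b ∈ fixSubgroup ψ, η = lam a * rho b := by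
  have : subN01 ψ = (ψ.ker.prod (fixSubgroup ψ)).map lamRho := by
    refine le_antisymm (sup_le ?_ ?_) ?_
    · rintro _ ⟨a, ha, rfl⟩
      exact ⟨(a, 1), ⟨ha, one_mem _⟩, by simp [lamRho_apply]⟩
    · rintro _ ⟨b, hb, rfl⟩
      exact ⟨(1, b), ⟨one_mem _, hb⟩, by simp [lamRho_apply]⟩
    · rintro _ ⟨⟨a, b⟩, ⟨ha, hb⟩, rfl⟩
      exact mul_mem (Subgroup.mem_sup_left ⟨a, ha, rfl⟩) (Subgroup.mem_sup_right ⟨b, hb, rfl⟩)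
  rw [this]
  constructor
  · rintro ⟨⟨a, b⟩, ⟨ha, hb⟩, rfl⟩
    exact ⟨a, ha, b, hb, rfl⟩
  · rintro ⟨a, ha, b, hb, rfl⟩
    exact ⟨(a, b), ⟨ha, hb⟩, rfl⟩

theorem coe_subN01 (ψ : G →* G) : (subN01 ψ : Set (Equiv.Perm G)) =
    nu ψ '' {x | ∃ a ∈ ψ.ker, ∃ b ∈ fixSubgroup ψ, x = a * b} := by
  ext η
  rw [SetLike.mem_coe, mem_subN01]
  constructor
  · rintro ⟨a, ha, b, hb, rfl⟩
    exact ⟨a * b⁻¹, ⟨a, ha, b⁻¹, inv_mem hb, rfl⟩, nu_mul_inv ha hb⟩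
  · rintro ⟨_, ⟨a, ha, b, hb, rfl⟩, rfl⟩
    exact ⟨a, ha, b⁻¹, inv_mem hb, by rw [← nu_mul_inv ha (inv_mem hb), inv_inv]⟩

/-- Evaluating at 1 gives `a = b`, an element both killed and fixed by `ψ`, hence trivial. -/
theorem eq_one_of_lam_mul_rho_eq_one {a b : G} (ha : a ∈ ψ.ker) (hb : b ∈ fixSubgroup ψ)
    (h : lam a * rho b = 1) : a = 1 ∧ b = 1 := by
  rw [← nu_mul_inv ha hb] at h
  have hab : a * b⁻¹ = 1 := by
    rw [← nu_apply_one ψ (a * b⁻¹), h, Equiv.Perm.one_apply]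
  have hab : a = b := mul_inv_eq_one.1 hab
  have hb1 : b = 1 := by
    rw [← mem_fixSubgroup.1 hb, ← hab, MonoidHom.mem_ker.1 ha]
  exact ⟨hab.trans hb1, hb1⟩

/-- `(a, b) ↦ λ(a) ρ(b)` is an isomorphism from `ker ψ × Fix ψ` to `N₀₁`. -/
theorem exists_kerProdFixEquiv (ψ : G →* G) : ∃ e : ψ.ker × fixSubgroup ψ ≃* subN01 ψ,
    ∀ a b, (e (a, b) : Equiv.Perm G) = lam (a : G) * rho (b : G) := by
  let f : ψ.ker × fixSubgroup ψ →* subN01 ψ :=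
    (lamRho.comp (ψ.ker.subtype.prodMap (fixSubgroup ψ).subtype)).codRestrict (subN01 ψ)
      fun x => mem_subN01.2 ⟨x.1, x.1.2, x.2, x.2.2, rfl⟩
  refine ⟨MulEquiv.ofBijective f ⟨?_, ?_⟩, fun a b => rfl⟩
  · refine (injective_iff_map_eq_one f).2 fun x hx => ?_
    have h := eq_one_of_lam_mul_rho_eq_one x.1.2 x.2.2 (congr_arg Subtype.val hx)
    exact Prod.ext (Subtype.ext h.1) (Subtype.ext h.2)
  · rintro ⟨η, hη⟩
    obtain ⟨a, ha, b, hb, rfl⟩ := mem_subN01.1 hη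
    exact ⟨(⟨a, ha⟩, ⟨b, hb⟩), rfl⟩

/-- `N₀₁` is the internal direct product of `N₀` and `N₁`. -/
theorem exists_prodEquiv_subN01 (j0 : subN0 ψ ≤ subN01 ψ) (j1 : subN1 ψ ≤ subN01 ψ) :
    ∃ e : subN0 ψ × subN1 ψ ≃* subN01 ψ,
      ∀ a b, e (a, b) = Subgroup.inclusion j0 a * Subgroup.inclusion j1 b := by
  have hcomm : ∀ (a : subN0 ψ) (b : subN1 ψ),
      Commute (Subgroup.inclusion j0 a) (Subgroup.inclusion j1 b) := by
    rintro ⟨_, a, ha, rfl⟩ ⟨_, b, hb, rfl⟩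
    exact Subtype.ext (lam_mul_rho_comm a b)
  let f : subN0 ψ × subN1 ψ →* subN01 ψ :=
    (Subgroup.inclusion j0).noncommCoprod (Subgroup.inclusion j1) hcomm
  refine ⟨MulEquiv.ofBijective f ⟨?_, ?_⟩, fun a b => rfl⟩
  · refine (injective_iff_map_eq_one f).2 ?_
    rintro ⟨⟨_, a, ha, rfl⟩, ⟨_, b, hb, rfl⟩⟩ hx
    obtain ⟨rfl, rfl⟩ := eq_one_of_lam_mul_rho_eq_one ha hb (congr_arg Subtype.val hx)
    exact Prod.ext (Subtype.ext (map_one _)) (Subtype.ext (map_one _))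
  · rintro ⟨η, hη⟩
    obtain ⟨a, ha, b, hb, rfl⟩ := mem_subN01.1 hη
    exact ⟨(⟨_, a, ha, rfl⟩, ⟨_, b, hb, rfl⟩), rfl⟩

theorem subN01_le_nuSubgroup
    (hψ : (⁅commEnd ψ, (⊤ : Subgroup G)⁆).map ψ ≤ Subgroup.center G) :
    subN01 ψ ≤ nuSubgroup ψ hψ := by
  intro η hη
  obtain ⟨a, ha, b, hb, rfl⟩ := mem_subN01.1 hη
  exact ⟨_, nu_mul_inv ha hb⟩

/-- Evaluation at 1 shows that `lam g` can only be `nu ψ g`; equality of the two at `k` says that `ψ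
g` commutes with `k`. -/
theorem lam_mem_nuSubgroup_iff
    (hψ : (⁅commEnd ψ, (⊤ : Subgroup G)⁆).map ψ ≤ Subgroup.center G) {g : G} :
    lam g ∈ nuSubgroup ψ hψ ↔ ψ g ∈ Subgroup.center G := by
  constructor
  · rintro ⟨g', h⟩
    have hg : g' = g := by
      have := Equiv.congr_fun h 1
      rwa [nu_apply_one, lam_apply, mul_one] at this
    subst hg
    refine Subgroup.mem_center_iff.2 fun k => ?_
    have := Equiv.congr_fun h k
    rw [nu_apply, lam_apply, mul_assoc, mul_assoc] at this
    exact inv_mul_eq_iff_eq_mul.1 (mul_left_cancel this)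
  · intro hg
    refine ⟨g, ?_⟩
    ext k
    rw [nu_apply, lam_apply, mul_assoc, Subgroup.mem_center_iff.1 hg k]
    group

/-- Here the only candidate is `nu ψ g⁻¹`, and comparing values at all points makes `g⁻¹ * ψ g`
central. -/
theorem rho_mem_nuSubgroup_iff
    (hψ : (⁅commEnd ψ, (⊤ : Subgroup G)⁆).map ψ ≤ Subgroup.center G) {g : G} :
    rho g ∈ nuSubgroup ψ hψ ↔ g * (ψ g)⁻¹ ∈ Subgroup.center G := by
  have hrho : rho g ∈ nuSubgroup ψ hψ ↔ nu ψ g⁻¹ = rho g := by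
    refine ⟨?_, fun h => ⟨_, h⟩⟩
    rintro ⟨g', h⟩
    have hg : g' = g⁻¹ := by
      have := Equiv.congr_fun h 1
      rwa [nu_apply_one, rho_apply, one_mul] at this
    rw [← hg, h]
  have hcenter : nu ψ g⁻¹ = rho g ↔ g⁻¹ * ψ g ∈ Subgroup.center G := by
    rw [Subgroup.mem_center_iff, Equiv.ext_iff]
    refine forall_congr' fun k => ?_
    rw [nu_apply, rho_apply, map_inv, inv_inv, mul_inv_eq_iff_eq_mul, mul_assoc k, eq_comm]
  -- Inverting `g⁻¹ * ψ g` and conjugating by `g` gives `g * (ψ g)⁻¹`, so one is central exactly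
  -- when the other is.
  have hn : (Subgroup.center G).Normal := inferInstance
  rw [hrho, hcenter]
  constructor <;> intro h
  · simpa [mul_assoc] using hn.conj_mem _ (inv_mem h) g
  · simpa [mul_assoc] using hn.conj_mem _ (inv_mem h) g⁻¹

theorem coe_lamPoints (hψ : (⁅commEnd ψ, (⊤ : Subgroup G)⁆).map ψ ≤ Subgroup.center G) :
    (lamPoints (nuSubgroup ψ hψ) : Set (Equiv.Perm G)) =
      {η | ∃ g, ψ g ∈ Subgroup.center G ∧ η = lam g} := by
  ext η
  constructor
  · rintro ⟨⟨g, rfl⟩, h⟩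
    exact ⟨g, (lam_mem_nuSubgroup_iff hψ).1 h, rfl⟩
  · rintro ⟨g, hg, rfl⟩
    exact ⟨⟨g, rfl⟩, (lam_mem_nuSubgroup_iff hψ).2 hg⟩

theorem coe_rhoPoints (hψ : (⁅commEnd ψ, (⊤ : Subgroup G)⁆).map ψ ≤ Subgroup.center G) :
    (rhoPoints (nuSubgroup ψ hψ) : Set (Equiv.Perm G)) =
      {η | ∃ g, g * (ψ g)⁻¹ ∈ Subgroup.center G ∧ η = rho g} := by
  ext η
  constructor
  · rintro ⟨⟨g, rfl⟩, h⟩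
    exact ⟨g, (rho_mem_nuSubgroup_iff hψ).1 h, rfl⟩
  · rintro ⟨g, hg, rfl⟩
    exact ⟨⟨g, rfl⟩, (rho_mem_nuSubgroup_iff hψ).2 hg⟩

theorem fixSubgroup_eq_range (hidem : ψ.comp ψ = ψ) : fixSubgroup ψ = ψ.range := by
  ext b
  constructor
  · exact fun hb => ⟨b, hb⟩
  · rintro ⟨g, rfl⟩
    exact DFunLike.congr_fun hidem g

/-- Idempotence splits `g` as `(g * (ψ g)⁻¹) * ψ g`, with first factor in the kernel and second
fixed by `ψ`. -/
theorem subN01_eq_nuSubgroup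
    (hψ : (⁅commEnd ψ, (⊤ : Subgroup G)⁆).map ψ ≤ Subgroup.center G) (hidem : ψ.comp ψ = ψ) :
    subN01 ψ = nuSubgroup ψ hψ := by
  refine le_antisymm (subN01_le_nuSubgroup hψ) ?_
  rintro _ ⟨g, rfl⟩
  have hg : ψ (ψ g) = ψ g := DFunLike.congr_fun hidem g
  rw [← SetLike.mem_coe, coe_subN01]
  refine ⟨g, ⟨g * (ψ g)⁻¹, ?_, ψ g, hg, by simp⟩, rfl⟩
  simp [MonoidHom.mem_ker, hg]

end RegularSubgroups

/-! ### Descent of bialgebra morphisms and of tensor products. -/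

/-- The isomorphism of bialgebras `A ⊗ B ≃ A ⊗ C` induced by a bijective morphism `B → C`. -/
def BialgEquiv.lTensorOfBijective {R : Type*} (A : Type*) {B C : Type*} [CommRing R] [Ring A]
    [Ring B] [Ring C] [Bialgebra R A] [Bialgebra R B] [Bialgebra R C] (f : B →ₐc[R] C)
    (hf : Function.Bijective f) : A ⊗[R] B ≃ₐc[R] A ⊗[R] C :=
  .ofBijective (BialgHom.lTensor A f)
    (TensorProduct.congr (LinearEquiv.refl R A)
      (LinearEquiv.ofBijective (f : B →ₗ[R] C) hf)).bijective

/-- Interchange of the middle factors is compatible with passing from `K` to `L`. It is needed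
because the comultiplication of a tensor product is defined through this interchange. -/
theorem tensorTensorTensorComm_tensorComparison {K L A B V W : Type*} [Field K] [Field L]
    [Algebra K L] [AddCommGroup A] [Module L A] [Module K A] [IsScalarTower K L A]
    [AddCommGroup B] [Module L B] [Module K B] [IsScalarTower K L B]
    [AddCommGroup V] [Module K V] [AddCommGroup W] [Module K W]
    (f : V →ₗ[K] A) (g : W →ₗ[K] B) (u : V ⊗[K] V) (v : W ⊗[K] W) :
    TensorProduct.AlgebraTensorModule.tensorTensorTensorComm L L L L A A B B
      (tensorComparison K L f f u ⊗ₜ tensorComparison K L g g v) =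
    tensorComparison K L (tensorComparison K L f g) (tensorComparison K L f g)
      (TensorProduct.AlgebraTensorModule.tensorTensorTensorComm K K K K V V W W (u ⊗ₜ v)) := by
  induction u with
  | zero => simp
  | add x y hx hy => simp only [map_add, TensorProduct.add_tmul, hx, hy]
  | tmul a b =>
    induction v with
    | zero => simp
    | add x y hx hy => simp only [map_add, TensorProduct.tmul_add, hx, hy]
    | tmul c d => rfl

namespace HopfAction

variable {K L G A B H : Type*} [Field K] [Field L] [Algebra K L] [Group G]
  [MulSemiringAction G L] [IsGaloisGroup G K L]
  [Ring A] [HopfAlgebra L A] [Algebra K A] [IsScalarTower K L A]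
  [Ring B] [HopfAlgebra L B] [Algebra K B] [IsScalarTower K L B]
  [Ring H] [Bialgebra K H]
  (D : HopfAction G L A) (E : HopfAction G L B)

/-- Transfers the comultiplication condition for `f` from `A ^ G ⊗ A ^ G` to `A ⊗[L] A`, where it
can be computed. -/
theorem incl₂_map (f : H →ₐ[K] D.inv K) (t : H ⊗[K] H) :
    D.incl₂ K (Algebra.TensorProduct.map f f t) =
      tensorComparison K L (D.incl K ∘ₗ f.toLinearMap) (D.incl K ∘ₗ f.toLinearMap) t := by
  induction t with
  | zero => simp
  | tmul a b => simp
  | add x y hx hy => rw [map_add, map_add, hx, hy, map_add]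

/-- The restriction to invariants of an equivariant morphism of bialgebras, as a morphism of
algebras. -/
def mapInvAlg (f : A →ₐc[L] B) (hf : ∀ g a, f (D.act g a) = E.act g (f a)) :
    D.inv K →ₐ[K] E.inv K :=
  (((f : A →ₐ[L] B).restrictScalars K).comp (D.inv K).val).codRestrict (E.inv K) fun x g => by
    change E.act g (f x) = f x
    rw [← hf, x.2 g]

theorem coe_mapInvAlg (f : A →ₐc[L] B) (hf : ∀ g a, f (D.act g a) = E.act g (f a))
    (x : D.inv K) : (D.mapInvAlg E f hf x : B) = f x := rfl

/-- The algebra morphism `A ^ G ⊗_K B ^ G → (A ⊗_L B) ^ G`. -/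
def tensorInvAlg : D.inv K ⊗[K] E.inv K →ₐ[K] (D.tensor E).inv K :=
  (Algebra.TensorProduct.algHomOfLinearMapTensorProduct
    (tensorComparison K L (D.incl K) (E.incl K)) (fun a₁ a₂ b₁ b₂ => by simp)
    (by simp [Algebra.TensorProduct.one_def])).codRestrict ((D.tensor E).inv K) fun x g => by
      change D.diag E.toSemilinearAction g (tensorComparison K L (D.incl K) (E.incl K) x) =
        tensorComparison K L (D.incl K) (E.incl K) x
      induction x with
      | zero => simp
      | tmul a b =>
        rw [tensorComparison_tmul, SemilinearAction.diag_tmul]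
        exact congr_arg₂ _ (a.2 g) (b.2 g)
      | add x y hx hy => rw [map_add, map_add, hx, hy]

theorem coe_tensorInvAlg (x : D.inv K ⊗[K] E.inv K) :
    (D.tensorInvAlg E x : A ⊗[L] B) = tensorComparison K L (D.incl K) (E.incl K) x := rfl

variable [Finite G]

theorem algebraMap_counit (x : D.inv K) :
    algebraMap K L (counit (R := K) x) = counit (R := L) (x : A) :=
  D.algebraMap_counitInv x

theorem incl₂_comul (x : D.inv K) : D.incl₂ K (comul (R := K) x) = comul (R := L) (x : A) :=
  D.incl₂_comulInv x

/-- An algebra morphism into `A ^ G` is a bialgebra morphism if it is compatible with the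
structure maps of `A`. -/
def bialgHomOfAlgHom (f : H →ₐ[K] D.inv K)
    (hcounit : ∀ x, counit (R := L) (f x : A) = algebraMap K L (counit (R := K) x))
    (hcomul : ∀ x, comul (R := L) (f x : A) =
      tensorComparison K L (D.incl K ∘ₗ f.toLinearMap) (D.incl K ∘ₗ f.toLinearMap)
        (comul (R := K) x)) : H →ₐc[K] D.inv K :=
  .ofAlgHom f
    (AlgHom.ext fun x => (algebraMap K L).injective <| by
      change algebraMap K L (counit (R := K) (f x)) = algebraMap K L (counit (R := K) x)
      rw [algebraMap_counit, hcounit])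
    (AlgHom.ext fun x => D.incl₂_injective <| by
      change D.incl₂ K (Algebra.TensorProduct.map f f (comul (R := K) x)) =
        D.incl₂ K (comul (R := K) (f x))
      rw [incl₂_comul, incl₂_map, hcomul])

/-- The restriction to invariants of an equivariant morphism of bialgebras. -/
def mapInv (f : A →ₐc[L] B) (hf : ∀ g a, f (D.act g a) = E.act g (f a)) :
    D.inv K →ₐc[K] E.inv K :=
  E.bialgHomOfAlgHom (D.mapInvAlg E f hf)
    (fun x => by
      rw [coe_mapInvAlg, algebraMap_counit]
      exact CoalgHomClass.counit_comp_apply f (x : A))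
    (fun x => by
      have key : ∀ t : D.inv K ⊗[K] D.inv K,
          TensorProduct.map (f : A →ₗ[L] B) (f : A →ₗ[L] B) (D.incl₂ K t) =
            tensorComparison K L
              (E.incl K ∘ₗ (D.mapInvAlg E f hf).toLinearMap)
              (E.incl K ∘ₗ (D.mapInvAlg E f hf).toLinearMap)
              t := by
        intro t
        induction t with
        | zero => simp
        | tmul a b => rfl
        | add x y hx hy => rw [map_add, map_add, hx, hy, map_add]
      rw [← key, incl₂_comul, coe_mapInvAlg]
      exact (CoalgHomClass.map_comp_comul_apply f (x : A)).symm)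

theorem mapInv_injective (f : A →ₐc[L] B) (hf : ∀ g a, f (D.act g a) = E.act g (f a))
    (hinj : Function.Injective f) : Function.Injective (D.mapInv (K := K) E f hf) :=
  fun _ _ h => Subtype.ext (hinj (congr_arg Subtype.val h))

theorem mapInv_bijective (f : A →ₐc[L] B) (hf : ∀ g a, f (D.act g a) = E.act g (f a))
    (hbij : Function.Bijective f) : Function.Bijective (D.mapInv (K := K) E f hf) := by
  refine ⟨D.mapInv_injective E f hf hbij.1, fun y => ?_⟩
  obtain ⟨x, hx⟩ := hbij.2 y
  -- The preimage of an invariant is invariant, by equivariance and injectivity of `f`.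
  refine ⟨⟨x, fun g => hbij.1 ?_⟩, Subtype.ext hx⟩
  rw [hf, hx, y.2 g]

/-- The comultiplication of an image `F x` is `F ⊗ F` applied to that of `x`, so it lies in the
tensor square of the range. Compatibility with the antipode enters separately, as `hanti`. -/
theorem isSubHopfAlgebra_range_mapInv (f : A →ₐc[L] B)
    (hf : ∀ g a, f (D.act g a) = E.act g (f a))
    (hanti : ∀ a, f (antipode L a) = antipode L (f a)) :
    IsSubHopfAlgebra (D.mapInv (K := K) E f hf : D.inv K →ₐ[K] E.inv K).range where
  comul_mem := by
    rintro _ ⟨x, rfl⟩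
    let F := D.mapInv (K := K) E f hf
    let F' := (F : D.inv K →ₐ[K] E.inv K).rangeRestrict
    refine ⟨TensorProduct.map F'.toLinearMap F'.toLinearMap (comul (R := K) x), ?_⟩
    rw [← LinearMap.comp_apply, ← TensorProduct.map_comp]
    exact CoalgHomClass.map_comp_comul_apply F x
  antipode_mem := by
    rintro _ ⟨x, rfl⟩
    refine ⟨antipode K x, Subtype.ext ?_⟩
    exact hanti x

/-- The bialgebra morphism `A ^ G ⊗_K B ^ G → (A ⊗_L B) ^ G`. -/
def tensorInv : D.inv K ⊗[K] E.inv K →ₐc[K] (D.tensor E).inv K :=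
  (D.tensor E).bialgHomOfAlgHom (D.tensorInvAlg E)
    (fun x => by
      rw [coe_tensorInvAlg]
      induction x with
      | zero => simp
      | tmul a b =>
        rw [tensorComparison_tmul, TensorProduct.counit_tmul, TensorProduct.counit_tmul,
          smul_eq_mul, smul_eq_mul, map_mul, algebraMap_counit, algebraMap_counit]
        rfl
      | add x y hx hy => rw [map_add, map_add, hx, hy, map_add, map_add])
    (fun x => by
      have key (u : D.inv K ⊗[K] D.inv K) (v : E.inv K ⊗[K] E.inv K) :=
        tensorTensorTensorComm_tensorComparison (L := L) (D.incl K) (E.incl K) u v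
      have hincl : (D.tensor E).incl K ∘ₗ (D.tensorInvAlg E).toLinearMap =
        tensorComparison K L (D.incl K) (E.incl K) := rfl
      rw [coe_tensorInvAlg, hincl]
      induction x with
      | zero => simp only [map_zero]
      | tmul a b =>
        rw [TensorProduct.comul_tmul, ← key, incl₂_comul, incl₂_comul, tensorComparison_tmul,
          TensorProduct.comul_tmul]
        rfl
      | add x y hx hy => simp only [map_add, hx, hy])

/-- Products of descended bases form a `K`-basis of the source whose image is an `L`-basis of `A
⊗[L] B` made of invariants. The first fact gives injectivity; invariance, which forces coordinates
of invariant vectors into `K`, gives surjectivity. -/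
theorem tensorInv_bijective : Function.Bijective (D.tensorInv (K := K) E) := by
  obtain ⟨s, b, b', hb⟩ := D.exists_basis (K := K)
  obtain ⟨t, c, c', hc⟩ := E.exists_basis (K := K)
  have hbc := tensorComparison_basis K L _ _ b b' c c' hb hc
  refine ⟨fun x y h => injective_of_basis _ _ _ hbc (congr_arg Subtype.val h), fun y => ?_⟩
  obtain ⟨x, hx⟩ := mem_range_of_invariant (fun g => D.diag E.toSemilinearAction g) _ _ _ hbc
    (fun i g => by
      rw [Module.Basis.tensorProduct_apply', SemilinearAction.diag_tmul, hb, hc]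
      rw [show D.act g (D.incl K (b i.1)) = _ from (b i.1).2 g,
        show E.act g (E.incl K (c i.2)) = _ from (c i.2).2 g]
      rfl) (y : A ⊗[L] B) y.2
  exact ⟨x, Subtype.ext hx⟩

/-- The isomorphism `A ^ G ⊗_K H ≃ (A ⊗_L B) ^ G` induced by an isomorphism `H → B ^ G`. -/
def tensorInvEquiv (f : H →ₐc[K] E.inv K) (hf : Function.Bijective f) :
    D.inv K ⊗[K] H ≃ₐc[K] (D.tensor E).inv K :=
  (BialgEquiv.lTensorOfBijective (D.inv K) f hf).trans
    (.ofBijective (D.tensorInv E) (D.tensorInv_bijective E))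

theorem coe_tensorInvEquiv_tmul (f : H →ₐc[K] E.inv K) (hf : Function.Bijective f)
    (x : D.inv K) (y : H) :
    (D.tensorInvEquiv E f hf (x ⊗ₜ y) : A ⊗[L] B) = (x : A) ⊗ₜ (f y : B) := rfl

end HopfAction

/-! ### Group algebras: functoriality, direct products, trivial actions. -/

section GroupAlgebras

variable {G K L M M₀ M₁ M' : Type*} [Group G] [Field K] [Field L] [Algebra K L]
  [MulSemiringAction G L] [IsGaloisGroup G K L] [Group M] [Group M'] [Group M₀] [Group M₁]

theorem groupAlgebraAction_single (α : G →* MulAut M) (g : G) (m : M) (l : L) :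
    (groupAlgebraAction L α).act g (MonoidAlgebra.single m l) =
      MonoidAlgebra.single (α g m) (g • l) :=
  groupAlgebraSemilinear_single α g m l

theorem mapDomainBialgHom_act (α : G →* MulAut M) (β : G →* MulAut M') (f : M →* M')
    (hf : ∀ g m, f (α g m) = β g (f m)) (g : G) (x : MonoidAlgebra L M) :
    MonoidAlgebra.mapDomainBialgHom L f ((groupAlgebraAction L α).act g x) =
      (groupAlgebraAction L β).act g (MonoidAlgebra.mapDomainBialgHom L f x) := by
  induction x using MonoidAlgebra.induction_linear with
  | zero => simp only [map_zero]
  | add x y hx hy => simp only [map_add, hx, hy]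
  | single m l =>
    rw [groupAlgebraAction_single, MonoidAlgebra.mapDomainBialgHom_single,
      MonoidAlgebra.mapDomainBialgHom_single, groupAlgebraAction_single, hf]

theorem mapDomainBialgHom_antipode (f : M →* M') (x : MonoidAlgebra L M) :
    MonoidAlgebra.mapDomainBialgHom L f (antipode L x) =
      antipode L (MonoidAlgebra.mapDomainBialgHom L f x) := by
  induction x using MonoidAlgebra.induction_linear with
  | zero => simp only [map_zero]
  | add x y hx hy => simp only [map_add, hx, hy]
  | single m l =>
    rw [MonoidAlgebra.antipode_single, MonoidAlgebra.mapDomainBialgHom_single,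
      MonoidAlgebra.mapDomainBialgHom_single, MonoidAlgebra.antipode_single, map_inv]

theorem mapDomainBialgHom_injective {f : M →* M'} (hf : Function.Injective f) :
    Function.Injective (MonoidAlgebra.mapDomainBialgHom L f) :=
  MonoidAlgebra.mapDomain_injective hf

variable (L) in
/-- If `M` is the internal direct product of the images of `f₀` and `f₁`, then multiplication is
an isomorphism of algebras from `L[M₀] ⊗ L[M₁]` to `L[M]`. -/
def groupAlgebraMulAlgEquiv (f₀ : M₀ →* M) (f₁ : M₁ →* M) (e : M₀ × M₁ ≃* M)
    (he : ∀ a b, e (a, b) = f₀ a * f₁ b) :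
    MonoidAlgebra L M₀ ⊗[L] MonoidAlgebra L M₁ ≃ₐ[L] MonoidAlgebra L M :=
  AlgEquiv.ofAlgHom
    (Algebra.TensorProduct.lift (MonoidAlgebra.mapDomainAlgHom L L f₀)
      (MonoidAlgebra.mapDomainAlgHom L L f₁) fun x y => by
        -- The images of `f₀` and `f₁` commute because `(a, 1)` and `(1, b)` do.
        have h (a : M₀) (b : M₁) : f₀ a * f₁ b = f₁ b * f₀ a := by
          have h0 : e (a, 1) = f₀ a := by simp [he]
          have h1 : e (1, b) = f₁ b := by simp [he]
          rw [← h0, ← h1, ← map_mul, ← map_mul]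
          simp
        induction x using MonoidAlgebra.induction_linear with
        | zero => simp
        | add x y hx hy => rw [map_add]; exact hx.add_left hy
        | single a l =>
          induction y using MonoidAlgebra.induction_linear with
          | zero => simp
          | add x y hx hy => rw [map_add]; exact hx.add_right hy
          | single b m => simp [Commute, SemiconjBy, h, mul_comm])
    -- The inverse sends the group element `e (a, b)` to `a ⊗ b`.
    (MonoidAlgebra.lift L _ M
      (MonoidHom.comp
        { toFun := fun x : M₀ × M₁ =>
            (MonoidAlgebra.single x.1 1 : MonoidAlgebra L M₀) ⊗ₜ[L]
              (MonoidAlgebra.single x.2 1 : MonoidAlgebra L M₁)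
          map_one' := rfl
          map_mul' := fun x y => by simp }
        e.symm.toMonoidHom))
    (by
      refine MonoidAlgebra.algHom_ext (fun m => ?_) (by ext)
      obtain ⟨⟨a, b⟩, rfl⟩ := e.surjective m
      simp [← he])
    (by
      ext a
      · have h0 : f₀ a = e (a, 1) := by simp [he]
        simp [h0, MonoidAlgebra.one_def]
      · have h1 : f₁ a = e (1, a) := by simp [he]
        simp [h1, MonoidAlgebra.one_def])

variable (L) in
/-- The same isomorphism, as an isomorphism of bialgebras. -/
def groupAlgebraMulEquiv (f₀ : M₀ →* M) (f₁ : M₁ →* M) (e : M₀ × M₁ ≃* M)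
    (he : ∀ a b, e (a, b) = f₀ a * f₁ b) :
    MonoidAlgebra L M₀ ⊗[L] MonoidAlgebra L M₁ ≃ₐc[L] MonoidAlgebra L M :=
  .ofAlgEquiv (groupAlgebraMulAlgEquiv L f₀ f₁ e he)
    (by ext <;> simp [groupAlgebraMulAlgEquiv, MonoidAlgebra.one_def])
    (by ext <;> simp [groupAlgebraMulAlgEquiv, MonoidAlgebra.one_def])

theorem groupAlgebraMulEquiv_tmul (f₀ : M₀ →* M) (f₁ : M₁ →* M) (e : M₀ × M₁ ≃* M)
    (he : ∀ a b, e (a, b) = f₀ a * f₁ b) (x : MonoidAlgebra L M₀) (y : MonoidAlgebra L M₁) :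
    groupAlgebraMulEquiv L f₀ f₁ e he (x ⊗ₜ y) =
      MonoidAlgebra.mapDomain f₀ x * MonoidAlgebra.mapDomain f₁ y := rfl

/-- A formula for arbitrary tensors is needed because an invariant of the tensor product need not be
a pure tensor. -/
theorem groupAlgebraMulEquiv_apply (f₀ : M₀ →* M) (f₁ : M₁ →* M) (e : M₀ × M₁ ≃* M)
    (he : ∀ a b, e (a, b) = f₀ a * f₁ b)
    (x : MonoidAlgebra L M₀ ⊗[L] MonoidAlgebra L M₁) :
    groupAlgebraMulEquiv L f₀ f₁ e he x =
      LinearMap.mul' L (MonoidAlgebra L M)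
        (TensorProduct.map (MonoidAlgebra.mapDomainAlgHom L L f₀).toLinearMap
          (MonoidAlgebra.mapDomainAlgHom L L f₁).toLinearMap x) := by
  induction x with
  | zero => simp only [map_zero]
  | add x y hx hy => simp only [map_add, hx, hy]
  | tmul x y => rfl

theorem groupAlgebraMulEquiv_act (f₀ : M₀ →* M) (f₁ : M₁ →* M) (e : M₀ × M₁ ≃* M)
    (he : ∀ a b, e (a, b) = f₀ a * f₁ b) (α₀ : G →* MulAut M₀) (α₁ : G →* MulAut M₁)
    (α : G →* MulAut M) (h₀ : ∀ g m, f₀ (α₀ g m) = α g (f₀ m))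
    (h₁ : ∀ g m, f₁ (α₁ g m) = α g (f₁ m)) (g : G)
    (x : MonoidAlgebra L M₀ ⊗[L] MonoidAlgebra L M₁) :
    groupAlgebraMulEquiv L f₀ f₁ e he
        (((groupAlgebraAction L α₀).tensor (groupAlgebraAction L α₁)).act g x) =
      (groupAlgebraAction L α).act g (groupAlgebraMulEquiv L f₀ f₁ e he x) := by
  induction x with
  | zero => simp only [map_zero]
  | add x y hx hy => simp only [map_add, hx, hy]
  | tmul x y =>
    change groupAlgebraMulEquiv L f₀ f₁ e he
      ((groupAlgebraAction L α₀).act g x ⊗ₜ (groupAlgebraAction L α₁).act g y) = _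
    rw [groupAlgebraMulEquiv_tmul, groupAlgebraMulEquiv_tmul, map_mul]
    exact congr_arg₂ _ (mapDomainBialgHom_act α₀ α f₀ h₀ g x)
      (mapDomainBialgHom_act α₁ α f₁ h₁ g y)

theorem act_mapAlgHom {α : G →* MulAut M} (hα : ∀ g m, α g m = m) (g : G)
    (x : MonoidAlgebra K M) :
    (groupAlgebraAction L α).act g (MonoidAlgebra.mapAlgHom M (Algebra.ofId K L) x) =
      MonoidAlgebra.mapAlgHom M (Algebra.ofId K L) x := by
  induction x using MonoidAlgebra.induction_linear with
  | zero => simp only [map_zero]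
  | add x y hx hy => simp only [map_add, hx, hy]
  | single m k =>
    have : MonoidAlgebra.mapAlgHom M (Algebra.ofId K L) (MonoidAlgebra.single m k) =
        MonoidAlgebra.single m (algebraMap K L k) := by simp
    rw [this, groupAlgebraAction_single, hα, smul_algebraMap]

/-- With `M` fixed pointwise, invariance of an element is invariance of each coefficient, so the
coefficients of an invariant lie in `K`. -/
theorem coeff_act {α : G →* MulAut M} (hα : ∀ g m, α g m = m) (g : G)
    (x : MonoidAlgebra L M) (m : M) :
    ((groupAlgebraAction L α).act g x).coeff m = g • x.coeff m := by
  classical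
  induction x using MonoidAlgebra.induction_linear with
  | zero => simp
  | add x y hx hy =>
    simp only [map_add, MonoidAlgebra.coeff_add, Finsupp.add_apply, hx, hy, smul_add]
  | single m' k =>
    rw [groupAlgebraAction_single, hα]
    simp [Finsupp.single_apply]

/-- If `G` acts trivially on `M`, then the invariants of `L[M]` are `K[M]`. -/
theorem inv_groupAlgebra_eq {α : G →* MulAut M} (hα : ∀ g m, α g m = m) :
    (groupAlgebraAction L α).inv K = (MonoidAlgebra.mapAlgHom M (Algebra.ofId K L)).range := by
  refine le_antisymm (fun x hx => ?_) ?_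
  · have hK : ∀ m, ∃ k : K, algebraMap K L k = x.coeff m := fun m =>
      Algebra.IsInvariant.isInvariant (G := G) _ fun g => by rw [← coeff_act hα, hx g]
    choose k hk using hK
    rw [← MonoidAlgebra.sum_coeff_single x]
    refine sum_mem fun m _ => ⟨MonoidAlgebra.single m (k m), ?_⟩
    simp [hk]
  · rintro _ ⟨x, rfl⟩ g
    exact act_mapAlgHom hα g x

variable [Finite G]

/-- Extension of coefficients as a morphism of bialgebras from `K[M]` to `L[M] ^ G`, if `G` acts
trivially on `M`. -/
def groupAlgebraToInv {α : G →* MulAut M} (hα : ∀ g m, α g m = m) :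
    MonoidAlgebra K M →ₐc[K] (groupAlgebraAction L α).inv K :=
  (groupAlgebraAction L α).bialgHomOfAlgHom
    ((MonoidAlgebra.mapAlgHom M (Algebra.ofId K L)).codRestrict _ fun x g =>
      act_mapAlgHom hα g x)
    (fun x => by
      change counit (R := L) (MonoidAlgebra.mapAlgHom M (Algebra.ofId K L) x) = _
      induction x using MonoidAlgebra.induction_linear with
      | zero => simp only [map_zero]
      | add x y hx hy => simp only [map_add, hx, hy]
      | single m k => simp)
    (fun x => by
      change comul (R := L) (MonoidAlgebra.mapAlgHom M (Algebra.ofId K L) x) =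
        tensorComparison K L (MonoidAlgebra.mapAlgHom M (Algebra.ofId K L)).toLinearMap
          (MonoidAlgebra.mapAlgHom M (Algebra.ofId K L)).toLinearMap (comul (R := K) x)
      induction x using MonoidAlgebra.induction_linear with
      | zero => simp only [map_zero]
      | add x y hx hy => simp only [map_add, hx, hy]
      | single m k => simp)

theorem coe_groupAlgebraToInv {α : G →* MulAut M} (hα : ∀ g m, α g m = m)
    (x : MonoidAlgebra K M) : (groupAlgebraToInv (L := L) hα x : MonoidAlgebra L M) =
      MonoidAlgebra.mapAlgHom M (Algebra.ofId K L) x := rfl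

/-- Injectivity is that of `K → L` on coefficients; surjectivity is `inv_groupAlgebra_eq`. -/
theorem groupAlgebraToInv_bijective {α : G →* MulAut M} (hα : ∀ g m, α g m = m) :
    Function.Bijective (groupAlgebraToInv (K := K) (L := L) hα) := by
  constructor
  · intro x y h
    have h' := congr_arg Subtype.val h
    rw [coe_groupAlgebraToInv, coe_groupAlgebraToInv] at h'
    refine MonoidAlgebra.ext (Finsupp.ext fun m => (algebraMap K L).injective ?_)
    have := congr_arg (fun z : MonoidAlgebra L M => z.coeff m) h'
    simpa [Algebra.ofId_apply] using this
  · rintro ⟨x, hx⟩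
    rw [inv_groupAlgebra_eq hα] at hx
    obtain ⟨y, rfl⟩ := hx
    exact ⟨y, rfl⟩

end GroupAlgebras

/-! ### Descended Hopf algebras of subgroups of `Perm G`. -/

section SubHopf

variable {G : Type*} (K L : Type*) [Group G] [Field K] [Field L] [Algebra K L]
  [MulSemiringAction G L] [IsGaloisGroup G K L] {M N M₀ M₁ : Subgroup (Equiv.Perm G)}

theorem conjAction_eq_of_le_rho (hM : NormalisedByLam M) (hρ : M ≤ rho.range) (g : G) (η : M) :
    conjAction hM g η = η :=
  Subtype.ext (lam_conj_of_le_rho hρ g η.2)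

variable [Finite G]

/-- Both actions are conjugation by the same `lam g`, so the inclusion is equivariant by definition
and descends. Nothing else about `M` and `N` is used, so one lemma covers all five subgroups. -/
theorem isSubHopfOf (hM : NormalisedByLam M) (hN : NormalisedByLam N) (hMN : M ≤ N) :
    IsSubHopfOf K L hM hN hMN := by
  have hact := mapDomainBialgHom_act (L := L) (conjAction hM) (conjAction hN)
    (Subgroup.inclusion hMN) fun _ _ => rfl
  exact ⟨HopfAction.mapInv _ _ _ hact, fun x => rfl,
    HopfAction.mapInv_injective _ _ _ hact
      (mapDomainBialgHom_injective (Subgroup.inclusion_injective hMN)),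
    HopfAction.isSubHopfAlgebra_range_mapInv _ _ _ hact (mapDomainBialgHom_antipode _)⟩

theorem invEqGroupAlgebra_of_le_rho (hM : NormalisedByLam M) (hρ : M ≤ rho.range) :
    InvEqGroupAlgebra K L hM :=
  ⟨inv_groupAlgebra_eq (conjAction_eq_of_le_rho hM hρ),
    .ofBijective (groupAlgebraToInv (conjAction_eq_of_le_rho hM hρ))
      (groupAlgebraToInv_bijective _), fun _ => rfl⟩

/-- If `M` is the internal direct product of `M₀` and `M₁`, then multiplication is an isomorphism
from `(L[M₀] ⊗_L L[M₁]) ^ G` to `L[M] ^ G`. -/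
def invMulEquiv (h₀ : NormalisedByLam M₀) (h₁ : NormalisedByLam M₁) (hM : NormalisedByLam M)
    (j₀ : M₀ ≤ M) (j₁ : M₁ ≤ M) (e : M₀ × M₁ ≃* M)
    (he : ∀ a b, e (a, b) = Subgroup.inclusion j₀ a * Subgroup.inclusion j₁ b) :
    ((groupAlgebraAction L (conjAction h₀)).tensor
      (groupAlgebraAction L (conjAction h₁))).inv K ≃ₐc[K] invAlg K L hM :=
  have hact := groupAlgebraMulEquiv_act (L := L) _ _ e he (conjAction h₀) (conjAction h₁)
    (conjAction hM) (fun _ _ => rfl) (fun _ _ => rfl)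
  .ofBijective (HopfAction.mapInv _ _ (groupAlgebraMulEquiv L _ _ e he : _ →ₐc[L] _) hact)
    (HopfAction.mapInv_bijective _ _ _ hact (groupAlgebraMulEquiv L _ _ e he).bijective)

theorem coe_invMulEquiv (h₀ : NormalisedByLam M₀) (h₁ : NormalisedByLam M₁)
    (hM : NormalisedByLam M) (j₀ : M₀ ≤ M) (j₁ : M₁ ≤ M) (e : M₀ × M₁ ≃* M)
    (he : ∀ a b, e (a, b) = Subgroup.inclusion j₀ a * Subgroup.inclusion j₁ b)
    (x : ((groupAlgebraAction L (conjAction h₀)).tensor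
      (groupAlgebraAction L (conjAction h₁))).inv K) :
    (invMulEquiv K L h₀ h₁ hM j₀ j₁ e he x : MonoidAlgebra L M) =
      groupAlgebraMulEquiv L _ _ e he (x : MonoidAlgebra L M₀ ⊗[L] MonoidAlgebra L M₁) := rfl

/-- If moreover `M₁ ≤ ρ(G)`, then `L[M₀] ^ G ⊗_K K[M₁]` is isomorphic to
`(L[M₀] ⊗_L L[M₁]) ^ G`. -/
def tensorGroupAlgebraEquiv (h₀ : NormalisedByLam M₀) (h₁ : NormalisedByLam M₁)
    (hρ : M₁ ≤ rho.range) :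
    invAlg K L h₀ ⊗[K] MonoidAlgebra K M₁ ≃ₐc[K]
      ((groupAlgebraAction L (conjAction h₀)).tensor
        (groupAlgebraAction L (conjAction h₁))).inv K :=
  have hα := conjAction_eq_of_le_rho h₁ hρ
  HopfAction.tensorInvEquiv (groupAlgebraAction L (conjAction h₀))
    (groupAlgebraAction L (conjAction h₁)) (groupAlgebraToInv (K := K) (L := L) hα)
    (groupAlgebraToInv_bijective (K := K) (L := L) hα)

theorem coe_tensorGroupAlgebraEquiv_tmul (h₀ : NormalisedByLam M₀) (h₁ : NormalisedByLam M₁)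
    (hρ : M₁ ≤ rho.range) (x : invAlg K L h₀) (y : MonoidAlgebra K M₁) :
    (tensorGroupAlgebraEquiv K L h₀ h₁ hρ (x ⊗ₜ y) :
      MonoidAlgebra L M₀ ⊗[L] MonoidAlgebra L M₁) =
      (x : MonoidAlgebra L M₀) ⊗ₜ MonoidAlgebra.mapAlgHom M₁ (Algebra.ofId K L) y :=
  HopfAction.coe_tensorInvEquiv_tmul ..

end SubHopf

end

theorem mainTheorem10 {G K L : Type*} [Group G] [Finite G] [Field K] [Field L] [Algebra K L]
    [MulSemiringAction G L] [IsGaloisGroup G K L] (ψ : G →* G)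
    (hψ : (⁅commEnd ψ, (⊤ : Subgroup G)⁆).map ψ ≤ Subgroup.center G) :
    ∃ N : Subgroup (Equiv.Perm G), (N : Set (Equiv.Perm G)) = Set.range (nu ψ) ∧
      IsRegularSubgroup N ∧
      -- the explicit descriptions of the five subgroups
      (subN0 ψ : Set (Equiv.Perm G)) = nu ψ '' ψ.ker ∧
      (subN1 ψ : Set (Equiv.Perm G)) = nu ψ '' fixSubgroup ψ ∧
      (subN01 ψ : Set (Equiv.Perm G)) =
        nu ψ '' {x | ∃ a ∈ ψ.ker, ∃ b ∈ fixSubgroup ψ, x = a * b} ∧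
      (∃ e : ψ.ker × fixSubgroup ψ ≃* subN01 ψ,
        ∀ a b, (e (a, b) : Equiv.Perm G) = lam (a : G) * rho (b : G)) ∧
      (lamPoints N : Set (Equiv.Perm G)) = {η | ∃ g, ψ g ∈ Subgroup.center G ∧ η = lam g} ∧
      (rhoPoints N : Set (Equiv.Perm G)) =
        {η | ∃ g, g * (ψ g)⁻¹ ∈ Subgroup.center G ∧ η = rho g} ∧
      -- they are subgroups of `N` normalised by `λ(G)`, and give sub-Hopf algebras
      ∃ (hN : NormalisedByLam N) (h0 : NormalisedByLam (subN0 ψ))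
        (h1 : NormalisedByLam (subN1 ψ)) (h01 : NormalisedByLam (subN01 ψ))
        (hl : NormalisedByLam (lamPoints N)) (hr : NormalisedByLam (rhoPoints N))
        (i0 : subN0 ψ ≤ N) (i1 : subN1 ψ ≤ N) (i01 : subN01 ψ ≤ N)
        (il : lamPoints N ≤ N) (ir : rhoPoints N ≤ N)
        (j0 : subN0 ψ ≤ subN01 ψ) (j1 : subN1 ψ ≤ subN01 ψ),
        IsSubHopfOf K L h0 hN i0 ∧ IsSubHopfOf K L h1 hN i1 ∧ IsSubHopfOf K L h01 hN i01 ∧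
        IsSubHopfOf K L hl hN il ∧ IsSubHopfOf K L hr hN ir ∧
        InvEqGroupAlgebra K L h1 ∧ InvEqGroupAlgebra K L hr ∧
        -- `L[N₀₁] ^ G ≅ (L[N₀] ⊗_L L[N₁]) ^ G`
        (∃ e : ((groupAlgebraAction L (conjAction h0)).tensor
              (groupAlgebraAction L (conjAction h1))).inv K ≃ₐc[K] invAlg K L h01,
          ∀ x, (e x : MonoidAlgebra L (subN01 ψ)) =
            LinearMap.mul' L (MonoidAlgebra L (subN01 ψ))
              (TensorProduct.map
                (MonoidAlgebra.mapDomainAlgHom L L (Subgroup.inclusion j0)).toLinearMap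
                (MonoidAlgebra.mapDomainAlgHom L L (Subgroup.inclusion j1)).toLinearMap
                (x : MonoidAlgebra L (subN0 ψ) ⊗[L] MonoidAlgebra L (subN1 ψ)))) ∧
        -- `L[N₀₁] ^ G ≅ L[N₀] ^ G ⊗_K K[N₁]`
        (∃ e : invAlg K L h0 ⊗[K] MonoidAlgebra K (subN1 ψ) ≃ₐc[K] invAlg K L h01,
          ∀ x y, (e (x ⊗ₜ y) : MonoidAlgebra L (subN01 ψ)) =
            MonoidAlgebra.mapDomain (Subgroup.inclusion j0) (x : MonoidAlgebra L (subN0 ψ)) *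
            MonoidAlgebra.mapDomain (Subgroup.inclusion j1)
              (MonoidAlgebra.mapAlgHom (subN1 ψ) (Algebra.ofId K L) y)) ∧
        -- the idempotent case
        (ψ ≠ 1 → ψ.comp ψ = ψ → subN01 ψ = N ∧
          ∃ e : ψ.ker × ψ.range ≃* N,
            ∀ a b, (e (a, b) : Equiv.Perm G) = lam (a : G) * rho (b : G)) := by
  have h0 : NormalisedByLam (subN0 ψ) := normalisedByLam_map_lam ψ.ker
  have h1 : NormalisedByLam (subN1 ψ) := normalisedByLam_of_le_rho (subN1_le_rho ψ)
  have h01 : NormalisedByLam (subN01 ψ) := h0.sup h1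
  have hN := normalisedByLam_nuSubgroup hψ
  have hl : NormalisedByLam (lamPoints (nuSubgroup ψ hψ)) := by
    refine NormalisedByLam.inf ?_ hN
    -- `λ(G)` is the image of the normal subgroup `⊤`.
    rw [MonoidHom.range_eq_map]
    exact normalisedByLam_map_lam ⊤
  have hr : NormalisedByLam (rhoPoints (nuSubgroup ψ hψ)) := normalisedByLam_of_le_rho inf_le_left
  have j0 : subN0 ψ ≤ subN01 ψ := le_sup_left
  have j1 : subN1 ψ ≤ subN01 ψ := le_sup_right
  have i01 := subN01_le_nuSubgroup hψ
  obtain ⟨e, he⟩ := exists_prodEquiv_subN01 j0 j1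
  refine ⟨nuSubgroup ψ hψ, rfl, isRegularSubgroup_nuSubgroup hψ, coe_subN0 ψ, coe_subN1 ψ,
    coe_subN01 ψ, exists_kerProdFixEquiv ψ, coe_lamPoints hψ, coe_rhoPoints hψ,
    hN, h0, h1, h01, hl, hr, j0.trans i01, j1.trans i01, i01, inf_le_right, inf_le_right, j0, j1,
    isSubHopfOf K L .., isSubHopfOf K L .., isSubHopfOf K L .., isSubHopfOf K L ..,
    isSubHopfOf K L .., invEqGroupAlgebra_of_le_rho K L h1 (subN1_le_rho ψ),
    invEqGroupAlgebra_of_le_rho K L hr inf_le_left,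
    ⟨invMulEquiv K L h0 h1 h01 j0 j1 e he, fun x => ?_⟩,
    ⟨(tensorGroupAlgebraEquiv K L h0 h1 (subN1_le_rho ψ)).trans
      (invMulEquiv K L h0 h1 h01 j0 j1 e he), fun x y => ?_⟩, fun _ hidem => ?_⟩
  · rw [coe_invMulEquiv, groupAlgebraMulEquiv_apply]
  · refine (coe_invMulEquiv K L h0 h1 h01 j0 j1 e he
      (tensorGroupAlgebraEquiv K L h0 h1 (subN1_le_rho ψ) (x ⊗ₜ y))).trans ?_
    rw [coe_tensorGroupAlgebraEquiv_tmul, groupAlgebraMulEquiv_tmul]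
  · have hN01 := subN01_eq_nuSubgroup hψ hidem
    refine ⟨hN01, ?_⟩
    -- For idempotent `ψ` the image is the fixed subgroup, so the isomorphism onto `subN01 ψ` is
    -- already the required one.
    rw [← hN01, ← fixSubgroup_eq_range hidem]
    exact exists_kerProdFixEquiv ψ
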